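/- Let $f_1,\dots,f_n:\mathbb{R}^p\to\mathbb{R}$ be differentiable, $\mu$-strongly convex with $L$-Lipschitz gradients ($\mu>0$): $\langle\nabla f_i(x)-\nabla f_i(x'),x-x'\rangle\ge\mu\|x-x'\|^2$ and $\|\nabla f_i(x)-\nabla f_i(x')\|\le L\|x-x'\|$ for all $x,x'$. Let $x^*$ be the minimizer of $f=\frac1n\sum_{i=1}^n f_i$. Let $W=[w_{ij}]\in\mathbb{R}^{n\times n}$ be nonnegative and doubly stochastic with $w_{ii}>0$ for some $i$, and suppose that the undirected graph on $\{1,\dots,n\}$ in which distinct $i,j$ are adjacent iff $w_{ij}>0$ and $w_{ji}>0$ is connected. Let $\rho_w$ be the spectral norm of $W-\frac1n\mathbf 1\mathbf 1^{\intercal}$, and let $\|\cdot\|$ denote the Euclidean norm of vectors and the Frobenius norm of matrices. Let $\xi_{i,k}$ ($1\le i\le n$, $k\ge0$) be random vectors in $\mathbb{R}^d$, independent over all $i$ and $k$, and let $g_i:\mathbb{R}^p\times\mathbb{R}^d\to\mathbb{R}^p$ be measurable with $\mathbb{E}[g_i(x,\xi_{i,k})]=\nabla f_i(x)$ and $\mathbb{E}[\|g_i(x,\xi_{i,k})-\nabla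 f_i(x)\|^2]\le\sigma^2$ for all $i$, $k$ and $x\in\mathbb{R}^p$, where $\sigma>0$. Let $\theta>1/\mu$, $\alpha_k=\theta/(k+1)$, and, for arbitrary (deterministic) $x_{i,0}$ and $y_{i,0}=g_i(x_{i,0},\xi_{i,0})$, let $$x_{i,k+1}=\sum_{j=1}^n w_{ij}(x_{j,k}-\alpha_k y_{j,k}),\qquad y_{i,k+1}=\sum_{j=1}^n w_{ij}y_{j,k}+g_i(x_{i,k+1},\xi_{i,k+1})-g_i(x_{i,k},\xi_{i,k}).$$ Write $\mathbf{x}_k,\mathbf{y}_k\in\mathbb{R}^{n\times p}$ for the matrices with rows $x_{i,k}$, $y_{i,k}$, and $\overline x_k=\frac1n\sum_i x_{i,k}$, $\overline y_k=\frac1n\sum_i y_{i,k}$. Let $m$ be a real number with $$m>\max\left\{\frac{\theta}{2}(\mu+L),\ \frac{4\theta L\rho_w^2+2\theta L\rho_w\sqrt{1+3\rho_w^2}}{1-\rho_w^2}\right\}$$ and, if $\rho_w\ne0$, $$\frac{(1-\rho_w^2)^2}{\theta^2(1+\rho_w^2)\rho_w^2}\left[\frac{1-\rho_w^2}{2}-\frac{2m+1}{(m+1)^2}\right]>\frac{1}{\theta\mu-1}\left(\frac1\mu+\frac{\theta}{m}\right)\frac{4\theta^2L^5}{m^3}+\frac{2C}{m^2},$$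 where $$C=\left[\left(\frac{1-\rho_w^2}{2\rho_w^2}-\frac{4\theta L}{m}-\frac{2\theta^2L^2}{m^2}\right)^{-1}+2\right]\|W-I\|^2L^2+\frac{3\theta L^3}{m}.$$ Then there are positive constants $\tilde U,\tilde X,\tilde Y$, not depending on $k$, such that for all integers $k\ge m$ the following expectations are finite and $$\mathbb{E}[\|\overline x_k-x^*\|^2]\le\frac{\tilde U}{k},\qquad \mathbb{E}[\|\mathbf{x}_k-\mathbf 1\overline x_k\|^2]\le\frac{\tilde X}{k^2},\qquad \mathbb{E}[\|\mathbf{y}_k-\mathbf 1\overline y_k\|^2]\le\tilde Y.$$ -/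

import Mathlib

open MeasureTheory ProbabilityTheory

noncomputable section

/-- The average `(1/n) ∑ i, v i` of `n` vectors: the row vector `(1/n) 1ᵀ v` of the stacked `v`. -/
def agentMean {n p : ℕ} (v : Fin n → EuclideanSpace ℝ (Fin p)) : EuclideanSpace ℝ (Fin p) :=
  (1 / (n : ℝ)) • ∑ i, v i

/-- The consensus error `‖v - 1 v̄‖²` in Frobenius norm, where the `n × p` matrix `v` is given by
its rows. -/
def consensusError {n p : ℕ} (v : Fin n → EuclideanSpace ℝ (Fin p)) : ℝ :=
  ∑ i, ‖v i - agentMean v‖ ^ 2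

/-- The spectral norm (`ℓ²` operator norm) of `W - (1/n) 1 1ᵀ`. -/
def mixingNorm {n : ℕ} (W : Matrix (Fin n) (Fin n) ℝ) : ℝ :=
  ‖Matrix.toEuclideanCLM (n := Fin n) (𝕜 := ℝ) (W - Matrix.of fun _ _ => 1 / (n : ℝ))‖

/-- The squared Frobenius norm of a square matrix. -/
def frobeniusSq {n : ℕ} (A : Matrix (Fin n) (Fin n) ℝ) : ℝ :=
  ∑ i, ∑ j, A i j ^ 2

/-- The coupling matrix is nonnegative and doubly stochastic with some positive diagonal entry. -/
structure IsCouplingMatrix {n : ℕ} (W : Matrix (Fin n) (Fin n) ℝ) : Prop where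
  nonneg : ∀ i j, 0 ≤ W i j
  row_sum : ∀ i, ∑ j, W i j = 1
  col_sum : ∀ j, ∑ i, W i j = 1
  diag_pos : ∃ i, 0 < W i i

/-- Distinct agents `i`, `j` are joined by an edge of the (undirected) communication graph exactly
when both weights `W i j` and `W j i` are positive. -/
def communicationGraph {n : ℕ} (W : Matrix (Fin n) (Fin n) ℝ) : SimpleGraph (Fin n) where
  Adj i j := i ≠ j ∧ 0 < W i j ∧ 0 < W j i
  symm := ⟨fun _ _ h => ⟨h.1.symm, h.2.2, h.2.1⟩⟩
  loopless := ⟨fun _ h => h.1 rfl⟩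

/-- `f` is differentiable and `μ`-strongly convex with `L`-Lipschitz gradient. -/
structure IsSmoothStronglyConvex {p : ℕ} (μ L : ℝ) (f : EuclideanSpace ℝ (Fin p) → ℝ) :
    Prop where
  differentiable : Differentiable ℝ f
  strong : ∀ x x' : EuclideanSpace ℝ (Fin p),
    μ * ‖x - x'‖ ^ 2 ≤ inner ℝ (gradient f x - gradient f x') (x - x')
  lipschitz : ∀ x x' : EuclideanSpace ℝ (Fin p),
    ‖gradient f x - gradient f x'‖ ≤ L * ‖x - x'‖

/-- Stochastic first-order oracle: the samples `ξ k i` (agent `i`, time `k`) are independent over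
all agents and times, and each `g i x (ξ k i)` is an unbiased estimate of `∇ f i x` with
variance at most `σ²`. -/
structure IsStochasticOracle {Ω : Type*} [MeasurableSpace Ω] (P : Measure Ω) {n p d : ℕ}
    (f : Fin n → EuclideanSpace ℝ (Fin p) → ℝ)
    (g : Fin n → EuclideanSpace ℝ (Fin p) → EuclideanSpace ℝ (Fin d) → EuclideanSpace ℝ (Fin p))
    (ξ : ℕ → Fin n → Ω → EuclideanSpace ℝ (Fin d)) (σ : ℝ) : Prop where
  measurable_oracle : ∀ i, Measurable (Function.uncurry (g i))
  measurable_sample : ∀ k i, Measurable (ξ k i)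
  indep : iIndepFun (fun q : ℕ × Fin n => ξ q.1 q.2) P
  integrable : ∀ k i x, Integrable (fun ω => g i x (ξ k i ω)) P
  unbiased : ∀ k i x, ∫ ω, g i x (ξ k i ω) ∂P = gradient (f i) x
  integrable_sq : ∀ k i x,
    Integrable (fun ω => ‖g i x (ξ k i ω) - gradient (f i) x‖ ^ 2) P
  variance_le : ∀ k i x, ∫ ω, ‖g i x (ξ k i ω) - gradient (f i) x‖ ^ 2 ∂P ≤ σ ^ 2

/-- The distributed stochastic gradient tracking method along one realisation `z k i` of the
samples, with stepsizes `α k` and initial points `x₀ i`; the value at time `k` is `(x_k, y_k)`: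
`x_{i,0} = x₀ i`, `y_{i,0} = g i x_{i,0} z_{i,0}`,
`x_{i,k+1} = ∑ j, w_{ij} (x_{j,k} - α_k y_{j,k})`,
`y_{i,k+1} = ∑ j, w_{ij} y_{j,k} + g i x_{i,k+1} z_{i,k+1} - g i x_{i,k} z_{i,k}`. -/
def dsgt {n p d : ℕ} (W : Matrix (Fin n) (Fin n) ℝ) (α : ℕ → ℝ)
    (g : Fin n → EuclideanSpace ℝ (Fin p) → EuclideanSpace ℝ (Fin d) → EuclideanSpace ℝ (Fin p))
    (x₀ : Fin n → EuclideanSpace ℝ (Fin p)) (z : ℕ → Fin n → EuclideanSpace ℝ (Fin d)) :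
    ℕ → (Fin n → EuclideanSpace ℝ (Fin p)) × (Fin n → EuclideanSpace ℝ (Fin p))
  | 0 => (x₀, fun i => g i (x₀ i) (z 0 i))
  | k + 1 =>
    let x := (dsgt W α g x₀ z k).1
    let y := (dsgt W α g x₀ z k).2
    let x' : Fin n → EuclideanSpace ℝ (Fin p) := fun i => ∑ j, W i j • (x j - α k • y j)
    (x', fun i => ∑ j, W i j • y j + g i (x' i) (z (k + 1) i) - g i (x i) (z k i))

/-- The constant `C` of the condition on `m`; here `ρ` stands for the spectral norm of
`W - (1/n) 1 1ᵀ` and `w` for the squared Frobenius norm of `W - I`. -/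
def offsetConst (L θ ρ w m : ℝ) : ℝ :=
  (((1 - ρ ^ 2) / (2 * ρ ^ 2) - 4 * θ * L / m - 2 * θ ^ 2 * L ^ 2 / m ^ 2)⁻¹ + 2) * w * L ^ 2
    + 3 * θ * L ^ 3 / m

/-- The condition on `m`. For `ρ = 0` the left-hand side of the second inequality has a zero
denominator (it is infinite) and only the first inequality is required. -/
def OffsetCondition (μ L θ ρ w m : ℝ) : Prop :=
  m > max (θ / 2 * (μ + L))
      ((4 * θ * L * ρ ^ 2 + 2 * θ * L * ρ * √(1 + 3 * ρ ^ 2)) / (1 - ρ ^ 2)) ∧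
    (ρ ≠ 0 →
      (1 - ρ ^ 2) ^ 2 / (θ ^ 2 * (1 + ρ ^ 2) * ρ ^ 2)
          * ((1 - ρ ^ 2) / 2 - (2 * m + 1) / (m + 1) ^ 2)
        > 1 / (θ * μ - 1) * (1 / μ + θ / m) * (4 * θ ^ 2 * L ^ 5 / m ^ 3)
          + 2 * offsetConst L θ ρ w m / m ^ 2)

end

/-! The proof couples three mean-square errors: a for the distance of the mean position to the
minimizer, b and c for the consensus errors of positions and trackers.

Since `W` has unit column sums, the mean tracker is the mean of the current sampled gradients. The
mean position thus follows a stochastic gradient method whose gradients are evaluated at the agents'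
own positions. Positions at time k depend on earlier samples only, so the current noise is centred
and orthogonal to them. Strong monotonicity then contracts a by 1 - θμ/(k+1), with errors of order
b/(k+1) and 1/(k+1)² (`IsStochasticOracle.integral_mean_step_le`).

Mixing contracts consensus errors by some q < 1 (`IsCouplingMatrix.exists_contraction`), a
qualitative gap obtained by compactness. Hence b contracts up to a term of order c/(k+1)². The
tracker error c contracts up to the second moments of two successive samples, which are bounded
affinely by a and b (`IsStochasticOracle.integral_sample_sq_le`).

Because θμ > 1, the system admits a ~ 1/k, b ~ 1/k², c ~ 1, by a simultaneous induction
(`exists_rates_of_eventually`). The feedback from a and b into c is of order 1/k, so starting late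
enough makes it harmless. The finitely many earlier times only enlarge the constants. -/

/-! ### Rates for a coupled system of three recursions -/

/-- The candidate bounds u₀Y/k, x₀Y/k², Y are preserved by one step once x₀, then u₀, then the
starting time M are fixed in this order. The scale Y comes last and covers the values at time M. -/
theorem exists_rates_of_eventually {a b c : ℕ → ℝ} {r K κ : ℝ}
    (hr0 : 0 ≤ r) (hr : r < 1) (hK : 0 ≤ K) (hκ : 1 < κ) (N : ℕ)
    (ha' : ∀ k ≥ N, a (k + 1) ≤
      (1 - κ / ((k : ℝ) + 1)) * a k + K / ((k : ℝ) + 1) * b k + K / ((k : ℝ) + 1) ^ 2)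
    (hb' : ∀ k ≥ N, b (k + 1) ≤ r * b k + K / ((k : ℝ) + 1) ^ 2 * c k)
    (hc' : ∀ k ≥ N, c (k + 1) ≤ r * c k + K * (1 + a k + b k + a (k + 1) + b (k + 1))) :
    ∃ (M : ℕ) (U X Y : ℝ), 0 < U ∧ 0 < X ∧ 0 < Y ∧ ∀ k ≥ M,
      a k ≤ U / k ∧ b k ≤ X / (k : ℝ) ^ 2 ∧ c k ≤ Y := by
  have h1r : 0 < 1 - r := by linarith
  have hδ : 0 < κ - 1 := by linarith
  -- Half of the contraction margin 1 - r of b pays for the forcing by c.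
  obtain ⟨x₀, hx₀, hx₀'⟩ : ∃ x₀ : ℝ, 0 < x₀ ∧ K ≤ (1 - r) / 2 * x₀ := by
    refine ⟨2 * K / (1 - r) + 1, by positivity, ?_⟩
    have : (1 - r) / 2 * (2 * K / (1 - r) + 1) = K + (1 - r) / 2 := by field_simp
    linarith
  -- The surplus κ - 1 over the decay of 1/k pays for the terms from b and the noise.
  obtain ⟨u₀, hu₀, hu₀'⟩ : ∃ u₀ : ℝ, 0 < u₀ ∧ K * x₀ + K ≤ (κ - 1) * u₀ := by
    refine ⟨(K * x₀ + K) / (κ - 1) + 1, by positivity, ?_⟩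
    have : (κ - 1) * ((K * x₀ + K) / (κ - 1) + 1) = K * x₀ + K + (κ - 1) := by field_simp
    linarith
  -- M exceeds N; M > κ keeps the coefficient of a nonnegative; the third bound makes the feedback
  -- into c small; the fourth makes ((k+1)/k)² close enough to 1.
  obtain ⟨M, hM⟩ := exists_nat_gt (max (max (N : ℝ) κ)
    (max (K * (2 * u₀ + 2 * x₀) / ((1 - r) / 2)) (6 / (1 - r) + 1)))
  simp only [max_lt_iff] at hM
  obtain ⟨⟨hMN, hMκ⟩, hM1, hM2⟩ := hM
  have hM2' : 6 ≤ (M : ℝ) * (1 - r) := by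
    have := (div_lt_iff₀ h1r).1 (show 6 / (1 - r) < M by linarith)
    linarith
  have hM1' : K * (2 * u₀ + 2 * x₀) ≤ (1 - r) / 2 * M := by
    have := (div_lt_iff₀ (by positivity)).1 hM1
    linarith
  have hM0 : (1 : ℝ) ≤ M := by linarith
  obtain ⟨Y, hY1, hYK, hYa, hYb, hYc⟩ : ∃ Y : ℝ, 1 ≤ Y ∧ K ≤ (1 - r) / 2 * Y ∧
      a M * M ≤ u₀ * Y ∧ b M * (M : ℝ) ^ 2 ≤ x₀ * Y ∧ c M ≤ Y := by
    refine ⟨1 + 2 * K / (1 - r) + |a M * M| / u₀ + |b M * (M : ℝ) ^ 2| / x₀ + |c M|, ?_⟩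
    have e1 : 0 ≤ 2 * K / (1 - r) := by positivity
    have e2 : 0 ≤ |a M * M| / u₀ := by positivity
    have e3 : 0 ≤ |b M * (M : ℝ) ^ 2| / x₀ := by positivity
    have e4 : 0 ≤ |c M| := by positivity
    refine ⟨by linarith, ?_, ?_, ?_, ?_⟩
    · have : (1 - r) / 2 * (2 * K / (1 - r)) = K := by field_simp
      exact this.ge.trans (by gcongr; linarith)
    · have : |a M * M| = u₀ * (|a M * M| / u₀) := by field_simp
      refine (le_abs_self _).trans ?_
      exact this.le.trans (by gcongr; linarith)
    · have : |b M * (M : ℝ) ^ 2| = x₀ * (|b M * (M : ℝ) ^ 2| / x₀) := by field_simp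
      refine (le_abs_self _).trans ?_
      exact this.le.trans (by gcongr; linarith)
    · linarith [le_abs_self (c M)]
  have hY0 : 0 < Y := by linarith
  refine ⟨M, u₀ * Y, x₀ * Y, Y, by positivity, by positivity, hY0, fun k hk => ?_⟩
  induction k, hk using Nat.le_induction with
  | base =>
    have : (0 : ℝ) < M := by linarith
    exact ⟨(le_div_iff₀ this).2 hYa, (le_div_iff₀ (by positivity)).2 hYb, hYc⟩
  | succ k hk ih =>
    obtain ⟨iha, ihb, ihc⟩ := ih
    have hkM : (M : ℝ) ≤ k := by exact_mod_cast hk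
    have hkN : N ≤ k := by
      have : (N : ℝ) ≤ k := by linarith
      exact_mod_cast this
    have hk1 : (1 : ℝ) ≤ k := by linarith
    have hk0 : (0 : ℝ) < k := by linarith
    have hsq : (k : ℝ) ≤ (k : ℝ) ^ 2 := le_self_pow₀ hk1 two_ne_zero
    have hsq' : (k : ℝ) ≤ ((k : ℝ) + 1) ^ 2 := by
      linarith [le_self_pow₀ (show (1 : ℝ) ≤ k + 1 by linarith) two_ne_zero]
    push_cast
    have A : a (k + 1) ≤ u₀ * Y / ((k : ℝ) + 1) := by
      have hcoef : 0 ≤ 1 - κ / ((k : ℝ) + 1) := by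
        rw [sub_nonneg, div_le_one (by positivity)]; linarith
      calc a (k + 1) ≤ (1 - κ / ((k : ℝ) + 1)) * (u₀ * Y / k)
            + K / ((k : ℝ) + 1) * (x₀ * Y / (k : ℝ) ^ 2) + K / ((k : ℝ) + 1) ^ 2 := by
            refine (ha' k hkN).trans ?_
            gcongr
        _ ≤ (1 - κ / ((k : ℝ) + 1)) * (u₀ * Y / k)
            + K / ((k : ℝ) + 1) * (x₀ * Y / k) + K * Y / (((k : ℝ) + 1) * k) := by
            have h2 : K ≤ K * Y := le_mul_of_one_le_right hK hY1
            have h3 : ((k : ℝ) + 1) * k ≤ ((k : ℝ) + 1) ^ 2 := by nlinarith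
            gcongr
        -- This uses (1 - κ/(k+1))/k = 1/(k+1) - (κ-1)/(k(k+1)).
        _ = u₀ * Y / ((k : ℝ) + 1)
            - ((κ - 1) * u₀ - (K * x₀ + K)) * (Y / (((k : ℝ) + 1) * k)) := by
            field_simp; ring
        _ ≤ _ := by
            have : 0 ≤ ((κ - 1) * u₀ - (K * x₀ + K)) * (Y / (((k : ℝ) + 1) * k)) :=
              mul_nonneg (by linarith) (by positivity)
            linarith
    have B : b (k + 1) ≤ x₀ * Y / ((k : ℝ) + 1) ^ 2 := by
      -- Passing from 1/k² to 1/(k+1)² costs at most half of the margin 1 - r.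
      have hq : r * ((k : ℝ) + 1) ^ 2 ≤ (1 + r) / 2 * (k : ℝ) ^ 2 := by
        have : 6 ≤ (k : ℝ) * (1 - r) := hM2'.trans (by gcongr)
        nlinarith
      calc b (k + 1) ≤ r * (x₀ * Y / (k : ℝ) ^ 2) + K / ((k : ℝ) + 1) ^ 2 * Y := by
            refine (hb' k hkN).trans ?_
            gcongr
        _ = (r * ((k : ℝ) + 1) ^ 2) * (x₀ * Y / ((k : ℝ) ^ 2 * ((k : ℝ) + 1) ^ 2))
            + K * (Y / ((k : ℝ) + 1) ^ 2) := by field_simp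
        _ ≤ ((1 + r) / 2 * (k : ℝ) ^ 2) * (x₀ * Y / ((k : ℝ) ^ 2 * ((k : ℝ) + 1) ^ 2))
            + ((1 - r) / 2 * x₀) * (Y / ((k : ℝ) + 1) ^ 2) := by gcongr
        _ = _ := by field_simp; ring
    refine ⟨A, B, ?_⟩
    have A' : a (k + 1) ≤ u₀ * Y / k := A.trans (by gcongr; linarith)
    have B1 : b k ≤ x₀ * Y / k := ihb.trans (div_le_div_of_nonneg_left (by positivity) hk0 hsq)
    have B' : b (k + 1) ≤ x₀ * Y / k :=
      B.trans (div_le_div_of_nonneg_left (by positivity) hk0 hsq')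
    calc c (k + 1) ≤ r * Y + K * (1 + u₀ * Y / k + x₀ * Y / k + u₀ * Y / k + x₀ * Y / k) := by
          refine (hc' k hkN).trans ?_
          gcongr
      _ = r * Y + K + (K * (2 * u₀ + 2 * x₀)) * (Y / k) := by ring
      _ ≤ r * Y + (1 - r) / 2 * Y + ((1 - r) / 2 * k) * (Y / k) := by
          have : (1 - r) / 2 * M ≤ (1 - r) / 2 * k := by gcongr
          exact add_le_add (add_le_add le_rfl hYK)
            (mul_le_mul_of_nonneg_right (hM1'.trans this) (by positivity))
      _ = Y := by field_simp; ring

/-- If the rates hold from some index on, they hold from index `1` on with larger constants. -/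
theorem exists_rates {a b c : ℕ → ℝ} {r K κ : ℝ} (ha : ∀ k, 0 ≤ a k) (hb : ∀ k, 0 ≤ b k)
    (hc : ∀ k, 0 ≤ c k) (hr0 : 0 ≤ r) (hr : r < 1) (hK : 0 ≤ K) (hκ : 1 < κ) (N : ℕ)
    (ha' : ∀ k ≥ N, a (k + 1) ≤
      (1 - κ / ((k : ℝ) + 1)) * a k + K / ((k : ℝ) + 1) * b k + K / ((k : ℝ) + 1) ^ 2)
    (hb' : ∀ k ≥ N, b (k + 1) ≤ r * b k + K / ((k : ℝ) + 1) ^ 2 * c k)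
    (hc' : ∀ k ≥ N, c (k + 1) ≤ r * c k + K * (1 + a k + b k + a (k + 1) + b (k + 1))) :
    ∃ U X Y : ℝ, 0 < U ∧ 0 < X ∧ 0 < Y ∧ ∀ k : ℕ, 0 < k →
      a k ≤ U / k ∧ b k ≤ X / (k : ℝ) ^ 2 ∧ c k ≤ Y := by
  obtain ⟨M, U, X, Y, hU, hX, hY, h⟩ :=
    exists_rates_of_eventually hr0 hr hK hκ N ha' hb' hc'
  have sa : ∀ k, 0 ≤ a k * k := fun k => mul_nonneg (ha k) (by positivity)
  have sb : ∀ k, 0 ≤ b k * (k : ℝ) ^ 2 := fun k => mul_nonneg (hb k) (by positivity)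
  have Sa : 0 ≤ ∑ j ∈ Finset.range M, a j * j := Finset.sum_nonneg fun j _ => sa j
  have Sb : 0 ≤ ∑ j ∈ Finset.range M, b j * (j : ℝ) ^ 2 := Finset.sum_nonneg fun j _ => sb j
  have Sc : 0 ≤ ∑ j ∈ Finset.range M, c j := Finset.sum_nonneg fun j _ => hc j
  refine ⟨U + ∑ j ∈ Finset.range M, a j * j, X + ∑ j ∈ Finset.range M, b j * (j : ℝ) ^ 2,
    Y + ∑ j ∈ Finset.range M, c j, by positivity, by positivity, by positivity, fun k hk => ?_⟩
  have hk' : (0 : ℝ) < k := by exact_mod_cast hk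
  rcases le_or_gt M k with hMk | hkM
  · obtain ⟨h1, h2, h3⟩ := h k hMk
    exact ⟨h1.trans (by gcongr; linarith), h2.trans (by gcongr; linarith), by linarith⟩
  · have hmem : k ∈ Finset.range M := Finset.mem_range.2 hkM
    refine ⟨(le_div_iff₀ hk').2 ?_, (le_div_iff₀ (by positivity)).2 ?_, ?_⟩
    · linarith [Finset.single_le_sum (fun j _ => sa j) hmem]
    · linarith [Finset.single_le_sum (fun j _ => sb j) hmem]
    · linarith [Finset.single_le_sum (fun j _ => hc j) hmem]

/-! ### Inequalities in normed and inner product spaces -/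

section InnerProduct

variable {E : Type*} [NormedAddCommGroup E]

theorem norm_add_sq_le_young (a b : E) {η : ℝ} (hη : 0 < η) :
    ‖a + b‖ ^ 2 ≤ (1 + η) * ‖a‖ ^ 2 + (1 + 1 / η) * ‖b‖ ^ 2 := by
  have h1 : ‖a + b‖ ^ 2 ≤ (‖a‖ + ‖b‖) ^ 2 := by gcongr; exact norm_add_le a b
  have h2 : (1 + η) * ‖a‖ ^ 2 + (1 + 1 / η) * ‖b‖ ^ 2 - (‖a‖ + ‖b‖) ^ 2
      = (η * ‖a‖ - ‖b‖) ^ 2 / η := by field_simp; ring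
  have h3 : 0 ≤ (η * ‖a‖ - ‖b‖) ^ 2 / η := by positivity
  linarith

theorem norm_add_sq_le_two (a b : E) : ‖a + b‖ ^ 2 ≤ 2 * ‖a‖ ^ 2 + 2 * ‖b‖ ^ 2 := by
  have := norm_add_sq_le_young a b one_pos
  norm_num at this; exact this

theorem norm_sub_sq_le_two (a b : E) : ‖a - b‖ ^ 2 ≤ 2 * ‖a‖ ^ 2 + 2 * ‖b‖ ^ 2 := by
  simpa [sub_eq_add_neg] using norm_add_sq_le_two a (-b)

variable [InnerProductSpace ℝ E]

/-- The variance identity for a finite probability vector. -/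
theorem sum_weight_mul_norm_sub_sq {ι : Type*} (s : Finset ι) (w : ι → ℝ) (hw : ∑ j ∈ s, w j = 1)
    (v : ι → E) :
    ∑ j ∈ s, w j * ‖v j - ∑ l ∈ s, w l • v l‖ ^ 2
      = ∑ j ∈ s, w j * ‖v j‖ ^ 2 - ‖∑ j ∈ s, w j • v j‖ ^ 2 := by
  set c := ∑ l ∈ s, w l • v l with hc
  have h : ∑ j ∈ s, w j * inner ℝ (v j) c = ‖c‖ ^ 2 := by
    rw [← real_inner_self_eq_norm_sq]
    nth_rw 2 [hc]
    rw [sum_inner]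
    exact Finset.sum_congr rfl fun j _ => (real_inner_smul_left _ _ _).symm
  calc ∑ j ∈ s, w j * ‖v j - c‖ ^ 2
      = ∑ j ∈ s, (w j * ‖v j‖ ^ 2 - 2 * (w j * inner ℝ (v j) c) + w j * ‖c‖ ^ 2) := by
        refine Finset.sum_congr rfl fun j _ => ?_
        rw [norm_sub_sq_real]; ring
    _ = _ := by
        rw [Finset.sum_add_distrib, Finset.sum_sub_distrib, ← Finset.mul_sum, h,
          ← Finset.sum_mul, hw]
        ring

theorem norm_sum_weight_sq_le {ι : Type*} (s : Finset ι) (w : ι → ℝ) (hw0 : ∀ j ∈ s, 0 ≤ w j)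
    (hw : ∑ j ∈ s, w j = 1) (v : ι → E) :
    ‖∑ j ∈ s, w j • v j‖ ^ 2 ≤ ∑ j ∈ s, w j * ‖v j‖ ^ 2 := by
  have h := sum_weight_mul_norm_sub_sq s w hw v
  have h0 : 0 ≤ ∑ j ∈ s, w j * ‖v j - ∑ l ∈ s, w l • v l‖ ^ 2 :=
    Finset.sum_nonneg fun j hj => mul_nonneg (hw0 j hj) (by positivity)
  linarith

/-- A gradient step of a strongly monotone Lipschitz field contracts towards its zero. -/
theorem norm_sub_smul_sq_le {μ L α : ℝ} (hα : 0 ≤ α) (e h : E)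
    (hmono : μ * ‖e‖ ^ 2 ≤ inner ℝ h e) (hlip : ‖h‖ ^ 2 ≤ L ^ 2 * ‖e‖ ^ 2) :
    ‖e - α • h‖ ^ 2 ≤ (1 - 2 * α * μ + α ^ 2 * L ^ 2) * ‖e‖ ^ 2 := by
  rw [norm_sub_sq_real, real_inner_smul_right, norm_smul, real_inner_comm, mul_pow,
    Real.norm_eq_abs, sq_abs]
  have h2 := mul_le_mul_of_nonneg_left hlip (sq_nonneg α)
  have h3 := mul_le_mul_of_nonneg_left hmono hα
  nlinarith

end InnerProduct

/-! ### Means and consensus errors -/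

section Mean

variable {n p : ℕ}

theorem agentMean_add (v w : Fin n → EuclideanSpace ℝ (Fin p)) :
    agentMean (v + w) = agentMean v + agentMean w := by
  simp [agentMean, Finset.sum_add_distrib]

theorem agentMean_smul (c : ℝ) (v : Fin n → EuclideanSpace ℝ (Fin p)) :
    agentMean (c • v) = c • agentMean v := by
  simp only [agentMean, Pi.smul_apply, ← Finset.smul_sum]
  rw [smul_comm]

theorem agentMean_sub (v w : Fin n → EuclideanSpace ℝ (Fin p)) :
    agentMean (v - w) = agentMean v - agentMean w := by
  simp [agentMean, Finset.sum_sub_distrib, smul_sub]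

theorem norm_agentMean_sq_le [NeZero n] (v : Fin n → EuclideanSpace ℝ (Fin p)) :
    ‖agentMean v‖ ^ 2 ≤ (1 / (n : ℝ)) * ∑ i, ‖v i‖ ^ 2 := by
  have hn : (n : ℝ) ≠ 0 := NeZero.ne _
  have := norm_sum_weight_sq_le Finset.univ (fun _ : Fin n => 1 / (n : ℝ))
    (fun _ _ => by positivity) (by simp [hn]) v
  rwa [← Finset.smul_sum, ← Finset.mul_sum] at this

theorem norm_agentMean_sq_le_sum [NeZero n] (v : Fin n → EuclideanSpace ℝ (Fin p)) :
    ‖agentMean v‖ ^ 2 ≤ ∑ i, ‖v i‖ ^ 2 := by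
  refine (norm_agentMean_sq_le v).trans (mul_le_of_le_one_left (by positivity) ?_)
  have : (1 : ℝ) ≤ n := by exact_mod_cast NeZero.one_le
  exact (div_le_one (by linarith)).2 this

theorem consensusError_nonneg (v : Fin n → EuclideanSpace ℝ (Fin p)) : 0 ≤ consensusError v :=
  Finset.sum_nonneg fun _ _ => by positivity

theorem consensusError_add_le (v w : Fin n → EuclideanSpace ℝ (Fin p)) {η : ℝ} (hη : 0 < η) :
    consensusError (v + w) ≤ (1 + η) * consensusError v + (1 + 1 / η) * consensusError w := by
  simp only [consensusError, agentMean_add, Finset.mul_sum, ← Finset.sum_add_distrib]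
  refine Finset.sum_le_sum fun i _ => ?_
  rw [Pi.add_apply, add_sub_add_comm]
  exact norm_add_sq_le_young _ _ hη

theorem consensusError_smul (c : ℝ) (v : Fin n → EuclideanSpace ℝ (Fin p)) :
    consensusError (c • v) = c ^ 2 * consensusError v := by
  simp only [consensusError, agentMean_smul, Finset.mul_sum]
  refine Finset.sum_congr rfl fun i _ => ?_
  rw [Pi.smul_apply, ← smul_sub, norm_smul, mul_pow, Real.norm_eq_abs, sq_abs]

theorem consensusError_le_sum [NeZero n] (v : Fin n → EuclideanSpace ℝ (Fin p)) :
    consensusError v ≤ ∑ i, ‖v i‖ ^ 2 := by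
  have hn : (n : ℝ) ≠ 0 := NeZero.ne _
  have hn0 : (0 : ℝ) < n := by positivity
  have h := sum_weight_mul_norm_sub_sq Finset.univ (fun _ : Fin n => 1 / (n : ℝ)) (by simp [hn]) v
  rw [← Finset.smul_sum, ← Finset.mul_sum, ← Finset.mul_sum] at h
  change (1 / (n : ℝ)) * consensusError v = _ at h
  have h2 : 1 / (n : ℝ) * consensusError v ≤ 1 / n * ∑ i, ‖v i‖ ^ 2 := by
    rw [h]; linarith [sq_nonneg ‖(1 / (n : ℝ)) • ∑ i, v i‖]
  exact le_of_mul_le_mul_left h2 (by positivity)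

theorem norm_sub_sq_le_consensusError (v : Fin n → EuclideanSpace ℝ (Fin p))
    (c : EuclideanSpace ℝ (Fin p)) (i : Fin n) :
    ‖v i - c‖ ^ 2 ≤ 2 * consensusError v + 2 * ‖agentMean v - c‖ ^ 2 := by
  have h1 : ‖v i - c‖ ^ 2 ≤ 2 * ‖v i - agentMean v‖ ^ 2 + 2 * ‖agentMean v - c‖ ^ 2 := by
    simpa using norm_add_sq_le_two (v i - agentMean v) (agentMean v - c)
  have h2 : ‖v i - agentMean v‖ ^ 2 ≤ consensusError v :=
    Finset.single_le_sum (f := fun j => ‖v j - agentMean v‖ ^ 2)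
      (fun _ _ => by positivity) (Finset.mem_univ i)
  linarith

end Mean

/-! ### Contraction by the coupling matrix -/

section Mixing

variable {n p : ℕ} {W : Matrix (Fin n) (Fin n) ℝ}

theorem IsCouplingMatrix.agentMean_mix (hW : IsCouplingMatrix W)
    (v : Fin n → EuclideanSpace ℝ (Fin p)) :
    agentMean (fun i => ∑ j, W i j • v j) = agentMean v := by
  simp only [agentMean]
  rw [Finset.sum_comm]
  simp [← Finset.sum_smul, hW.col_sum]

theorem IsCouplingMatrix.sum_sum_weight (hW : IsCouplingMatrix W) (u : Fin n → ℝ) :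
    ∑ i, ∑ j, W i j * u j = ∑ j, u j := by
  rw [Finset.sum_comm]
  simp [← Finset.sum_mul, hW.col_sum]

/-- If mixing does not decrease the sum of squares, then all agents agree. -/
theorem IsCouplingMatrix.eq_of_sum_le (hW : IsCouplingMatrix W)
    (hG : (communicationGraph W).Connected) (v : Fin n → EuclideanSpace ℝ (Fin p))
    (h : ∑ i, ‖v i‖ ^ 2 ≤ ∑ i, ‖∑ j, W i j • v j‖ ^ 2) : ∃ c, ∀ i, v i = c := by
  have hvar : ∀ i, ∑ j, W i j * ‖v j - ∑ l, W i l • v l‖ ^ 2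
      = ∑ j, W i j * ‖v j‖ ^ 2 - ‖∑ j, W i j • v j‖ ^ 2 := fun i =>
    sum_weight_mul_norm_sub_sq Finset.univ (W i) (hW.row_sum i) v
  have hnn : ∀ i j, 0 ≤ W i j * ‖v j - ∑ l, W i l • v l‖ ^ 2 := fun i j =>
    mul_nonneg (hW.nonneg i j) (by positivity)
  have hzero : ∑ i, ∑ j, W i j * ‖v j - ∑ l, W i l • v l‖ ^ 2 = 0 := by
    refine le_antisymm ?_ (Finset.sum_nonneg fun i _ => Finset.sum_nonneg fun j _ => hnn i j)
    simp only [hvar, Finset.sum_sub_distrib, hW.sum_sum_weight]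
    linarith
  -- The total variance over all rows vanishes, so every j with positive weight in row i carries the
  -- same value.
  have hloc : ∀ i j, 0 < W i j → v j = ∑ l, W i l • v l := by
    intro i j hij
    have h1 := (Finset.sum_eq_zero_iff_of_nonneg
      (fun i _ => Finset.sum_nonneg fun j _ => hnn i j)).1 hzero i (Finset.mem_univ i)
    have h2 := (Finset.sum_eq_zero_iff_of_nonneg (fun j _ => hnn i j)).1 h1 j (Finset.mem_univ j)
    have h3 := (mul_eq_zero.1 h2).resolve_left hij.ne'
    simpa [sub_eq_zero] using h3
  obtain ⟨i₀, hi₀⟩ := hW.diag_pos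
  refine ⟨v i₀, fun i => ?_⟩
  -- Row equality only links vertices with a common neighbour, that is, two steps apart. The
  -- positive diagonal entry at i₀ removes this parity obstruction; including the neighbours of i in
  -- the claim carries both parities along the walk.
  have key : ∀ i, (communicationGraph W).Reachable i₀ i →
      v i = v i₀ ∧ ∀ j, (communicationGraph W).Adj i j → v j = v i₀ := by
    intro i hi
    rw [SimpleGraph.reachable_iff_reflTransGen] at hi
    induction hi with
    | refl => exact ⟨rfl, fun j hj => (hloc i₀ j hj.2.1).trans (hloc i₀ i₀ hi₀).symm⟩
    | @tail a b _ hab ih =>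
      refine ⟨ih.2 b hab, fun j hj => ?_⟩
      rw [hloc b j hj.2.1, ← hloc b a hab.2.2, ih.1]
  exact (key i (hG.preconnected i₀ i)).1

/-- Mixing contracts the consensus error by a factor less than one. -/
theorem IsCouplingMatrix.exists_contraction (hW : IsCouplingMatrix W)
    (hG : (communicationGraph W).Connected) (p : ℕ) :
    ∃ q : ℝ, 0 ≤ q ∧ q < 1 ∧ ∀ v : Fin n → EuclideanSpace ℝ (Fin p),
      consensusError (fun i => ∑ j, W i j • v j) ≤ q * consensusError v := by
  have : Nonempty (Fin n) := hG.nonempty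
  have : NeZero n := ⟨by rintro rfl; exact isEmptyElim (Classical.arbitrary (Fin 0))⟩
  have hn : (n : ℝ) ≠ 0 := NeZero.ne _
  -- On the compact unit sphere of centred configurations the mixed energy is below 1 pointwise,
  -- hence uniformly.
  let S : Set (Fin n → EuclideanSpace ℝ (Fin p)) := {v | ∑ i, ‖v i‖ ^ 2 = 1 ∧ ∑ i, v i = 0}
  let φ : (Fin n → EuclideanSpace ℝ (Fin p)) → ℝ := fun v => ∑ i, ‖∑ j, W i j • v j‖ ^ 2
  have hφ : Continuous φ := by fun_prop
  have hS : IsCompact S := by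
    refine Metric.isCompact_of_isClosed_isBounded ?_ ?_
    · exact (isClosed_eq (by fun_prop) continuous_const).inter
        (isClosed_eq (by fun_prop) continuous_const)
    · refine (Metric.isBounded_closedBall (x := 0) (r := 1)).subset fun v hv => ?_
      rw [mem_closedBall_zero_iff, pi_norm_le_iff_of_nonneg zero_le_one]
      intro i
      have : ‖v i‖ ^ 2 ≤ 1 := hv.1 ▸ Finset.single_le_sum (f := fun j => ‖v j‖ ^ 2)
        (fun _ _ => by positivity) (Finset.mem_univ i)
      exact (sq_le_one_iff₀ (norm_nonneg _)).1 this
  have hlt : ∀ v ∈ S, φ v < 1 := by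
    intro v hv
    by_contra! hcon
    obtain ⟨c, hc⟩ := hW.eq_of_sum_le hG v (hv.1.trans_le hcon)
    have h1 : (n : ℝ) • c = 0 := by
      have := hv.2
      simpa [hc, ← Nat.cast_smul_eq_nsmul ℝ] using this
    have h2 : c = 0 := (smul_eq_zero.1 h1).resolve_left hn
    have := hv.1
    simp [hc, h2] at this
  obtain ⟨q, hq0, hq1, hq⟩ : ∃ q : ℝ, 0 ≤ q ∧ q < 1 ∧ ∀ v ∈ S, φ v ≤ q := by
    -- The sphere is empty for a single agent or in dimension zero.
    rcases S.eq_empty_or_nonempty with h | h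
    · exact ⟨0, le_rfl, zero_lt_one, by simp [h]⟩
    · obtain ⟨v, hv, hmax⟩ := hS.exists_isMaxOn h hφ.continuousOn
      exact ⟨φ v, Finset.sum_nonneg fun _ _ => by positivity, hlt v hv, fun u hu => hmax hu⟩
  have hcentred : ∀ u : Fin n → EuclideanSpace ℝ (Fin p), ∑ i, u i = 0 →
      φ u ≤ q * ∑ i, ‖u i‖ ^ 2 := by
    intro u hu
    rcases (Finset.sum_nonneg fun i _ => by positivity :
      0 ≤ ∑ i, ‖u i‖ ^ 2).eq_or_lt with h0 | h0
    · have : ∀ i, u i = 0 := fun i => by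
        have := (Finset.sum_eq_zero_iff_of_nonneg (fun i _ => by positivity)).1 h0.symm i
          (Finset.mem_univ i)
        simpa using this
      simp [φ, this]
    · set s := ∑ i, ‖u i‖ ^ 2 with hs
      have hsq : √s ^ 2 = s := Real.sq_sqrt h0.le
      have hs0 : 0 < √s := Real.sqrt_pos.2 h0
      have hmem : (√s)⁻¹ • u ∈ S := by
        constructor
        · simp only [Pi.smul_apply, norm_smul, mul_pow, ← Finset.mul_sum, ← hs]
          rw [Real.norm_eq_abs, sq_abs, inv_pow, hsq, inv_mul_cancel₀ h0.ne']
        · simp [← Finset.smul_sum, hu]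
      have h1 := hq _ hmem
      have h2 : φ ((√s)⁻¹ • u) = s⁻¹ * φ u := by
        simp only [φ, Pi.smul_apply, smul_comm _ (√s)⁻¹, ← Finset.smul_sum, norm_smul, mul_pow,
          ← Finset.mul_sum]
        rw [Real.norm_eq_abs, sq_abs, inv_pow, hsq]
      rw [h2, inv_mul_le_iff₀ h0] at h1
      linarith
  refine ⟨q, hq0, hq1, fun v => ?_⟩
  have h := hcentred (fun i => v i - agentMean v) (by
    simp [Finset.sum_sub_distrib, agentMean, ← Nat.cast_smul_eq_nsmul ℝ, smul_smul, hn])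
  refine le_trans (le_of_eq ?_) h
  simp only [consensusError, hW.agentMean_mix, φ]
  refine Finset.sum_congr rfl fun i _ => ?_
  -- Unit row sums let mixing commute with subtracting the mean.
  simp [smul_sub, Finset.sum_sub_distrib, ← Finset.sum_smul, hW.row_sum]

end Mixing

/-! ### Noise along a random state independent of the sample -/

section Noise

variable {Ω S T E : Type*} [MeasurableSpace Ω] [MeasurableSpace S] [MeasurableSpace T]
  [NormedAddCommGroup E] [MeasurableSpace E] [BorelSpace E] {P : Measure Ω}
  {X : Ω → S} {Z : Ω → T} {φ : S → T → E}

/-- Noise whose second moment is bounded for each frozen state has the same bound along a random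
state that is independent of the sample. -/
theorem integrable_and_integral_norm_sq_le_of_indepFun [IsProbabilityMeasure P] (hX : Measurable X) (hZ : Measurable Z)
    (hXZ : IndepFun X Z P) (hφ : Measurable (Function.uncurry φ)) {s : ℝ}
    (hint : ∀ x, Integrable (fun ω => ‖φ x (Z ω)‖ ^ 2) P)
    (hle : ∀ x, ∫ ω, ‖φ x (Z ω)‖ ^ 2 ∂P ≤ s) :
    Integrable (fun ω => ‖φ (X ω) (Z ω)‖ ^ 2) P ∧ ∫ ω, ‖φ (X ω) (Z ω)‖ ^ 2 ∂P ≤ s := by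
  -- Independence makes the joint law a product, so Fubini freezes the state and takes the place of
  -- conditional expectation.
  have hlaw := (indepFun_iff_map_prod_eq_prod_map_map hX.aemeasurable hZ.aemeasurable).1 hXZ
  have : IsProbabilityMeasure (P.map X) := Measure.isProbabilityMeasure_map hX.aemeasurable
  have : IsProbabilityMeasure (P.map Z) := Measure.isProbabilityMeasure_map hZ.aemeasurable
  let F : S × T → ℝ := fun q => ‖φ q.1 q.2‖ ^ 2
  have hF : Measurable F := hφ.norm.pow_const 2
  have hFx : ∀ x, Measurable fun z => F (x, z) := fun x => hF.comp measurable_prodMk_left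
  have hmap : ∀ x, ∫ z, F (x, z) ∂(P.map Z) = ∫ ω, ‖φ x (Z ω)‖ ^ 2 ∂P := fun x =>
    integral_map hZ.aemeasurable (hFx x).aestronglyMeasurable
  have hnn : ∀ x, 0 ≤ ∫ z, F (x, z) ∂(P.map Z) := fun x => integral_nonneg fun z => by positivity
  have hint2 : Integrable (fun x => ∫ z, F (x, z) ∂(P.map Z)) (P.map X) := by
    refine Integrable.mono' (integrable_const s)
      hF.stronglyMeasurable.integral_prod_right'.aestronglyMeasurable
      (Filter.Eventually.of_forall fun x => ?_)
    rw [Real.norm_of_nonneg (hnn x), hmap]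
    exact hle x
  have hFint : Integrable F ((P.map X).prod (P.map Z)) := by
    refine (integrable_prod_iff hF.aestronglyMeasurable).2 ⟨?_, ?_⟩
    · exact Filter.Eventually.of_forall fun x =>
        (integrable_map_measure (hFx x).aestronglyMeasurable hZ.aemeasurable).2 (hint x)
    · refine hint2.congr (Filter.Eventually.of_forall fun x => integral_congr_ae
        (Filter.Eventually.of_forall fun z => ?_))
      exact (Real.norm_of_nonneg (by positivity)).symm
  have hpair : Measurable fun ω => (X ω, Z ω) := hX.prodMk hZ
  constructor
  · rw [← hlaw] at hFint
    exact (integrable_map_measure hF.aestronglyMeasurable hpair.aemeasurable).1 hFint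
  · calc ∫ ω, ‖φ (X ω) (Z ω)‖ ^ 2 ∂P = ∫ q, F q ∂(P.map fun ω => (X ω, Z ω)) :=
          (integral_map hpair.aemeasurable hF.aestronglyMeasurable).symm
      _ = ∫ x, ∫ z, F (x, z) ∂(P.map Z) ∂(P.map X) := by rw [hlaw, integral_prod F hFint]
      _ ≤ ∫ _, s ∂(P.map X) :=
          integral_mono hint2 (integrable_const s) fun x => (hmap x).trans_le (hle x)
      _ = s := by simp

variable [InnerProductSpace ℝ E] [SecondCountableTopology E]

theorem integrable_inner_of_norm_sq {u v : Ω → E} (hu : Measurable u) (hv : Measurable v)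
    (hu2 : Integrable (fun ω => ‖u ω‖ ^ 2) P) (hv2 : Integrable (fun ω => ‖v ω‖ ^ 2) P) :
    Integrable (fun ω => inner ℝ (u ω) (v ω)) P := by
  refine Integrable.mono' (hu2.add hv2) (hu.inner hv).aestronglyMeasurable
    (Filter.Eventually.of_forall fun ω => ?_)
  refine (norm_inner_le_norm _ _).trans ?_
  simp only [Pi.add_apply]
  nlinarith [sq_nonneg (‖u ω‖ - ‖v ω‖), sq_nonneg ‖u ω‖, sq_nonneg ‖v ω‖]

/-- Noise that is centred for each frozen state is orthogonal to every function of a random state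
that is independent of the sample. -/
theorem integral_inner_eq_zero_of_indepFun [IsProbabilityMeasure P] [CompleteSpace E]
    (hX : Measurable X) (hZ : Measurable Z) (hXZ : IndepFun X Z P) (hφ : Measurable (Function.uncurry φ))
    {ψ : S → E} (hψ : Measurable ψ) (hint : ∀ x, Integrable (fun ω => φ x (Z ω)) P)
    (hzero : ∀ x, ∫ ω, φ x (Z ω) ∂P = 0)
    (hin : Integrable (fun ω => inner ℝ (ψ (X ω)) (φ (X ω) (Z ω))) P) :
    ∫ ω, inner ℝ (ψ (X ω)) (φ (X ω) (Z ω)) ∂P = 0 := by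
  have hlaw := (indepFun_iff_map_prod_eq_prod_map_map hX.aemeasurable hZ.aemeasurable).1 hXZ
  have : IsProbabilityMeasure (P.map X) := Measure.isProbabilityMeasure_map hX.aemeasurable
  have : IsProbabilityMeasure (P.map Z) := Measure.isProbabilityMeasure_map hZ.aemeasurable
  let F : S × T → ℝ := fun q => inner ℝ (ψ q.1) (φ q.1 q.2)
  have hF : Measurable F := (hψ.comp measurable_fst).inner hφ
  have hpair : Measurable fun ω => (X ω, Z ω) := hX.prodMk hZ
  have hFint : Integrable F ((P.map X).prod (P.map Z)) := by
    rw [← hlaw]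
    exact (integrable_map_measure hF.aestronglyMeasurable hpair.aemeasurable).2 hin
  calc ∫ ω, inner ℝ (ψ (X ω)) (φ (X ω) (Z ω)) ∂P
      = ∫ q, F q ∂(P.map fun ω => (X ω, Z ω)) :=
        (integral_map hpair.aemeasurable hF.aestronglyMeasurable).symm
    _ = ∫ x, ∫ z, F (x, z) ∂(P.map Z) ∂(P.map X) := by rw [hlaw, integral_prod F hFint]
    _ = ∫ _, 0 ∂(P.map X) := by
        refine integral_congr_ae (Filter.Eventually.of_forall fun x => ?_)
        change ∫ z, F (x, z) ∂(P.map Z) = 0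
        have hFx : Measurable fun z => F (x, z) := hF.comp measurable_prodMk_left
        rw [integral_map hZ.aemeasurable hFx.aestronglyMeasurable]
        change ∫ ω, inner ℝ (ψ x) (φ x (Z ω)) ∂P = 0
        rw [integral_inner (hint x), hzero, inner_zero_right]
    _ = 0 := by simp

end Noise

/-! ### Measurability and causality of the iterates -/

section Iterates

variable {n p d : ℕ} {W : Matrix (Fin n) (Fin n) ℝ} {α : ℕ → ℝ}
  {g : Fin n → EuclideanSpace ℝ (Fin p) → EuclideanSpace ℝ (Fin d) → EuclideanSpace ℝ (Fin p)}
  {x₀ : Fin n → EuclideanSpace ℝ (Fin p)}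

theorem measurable_dsgt (hg : ∀ i, Measurable (Function.uncurry (g i))) (k : ℕ) :
    Measurable fun z : ℕ → Fin n → EuclideanSpace ℝ (Fin d) => dsgt W α g x₀ z k := by
  have hgc : ∀ (i : Fin n) (k : ℕ)
      (u : (ℕ → Fin n → EuclideanSpace ℝ (Fin d)) → Fin n → EuclideanSpace ℝ (Fin p)),
      Measurable u → Measurable fun z => g i (u z i) (z k i) := fun i k u hu =>
    (hg i).comp (((measurable_pi_apply i).comp hu).prodMk
      ((measurable_pi_apply i).comp (measurable_pi_apply k)))
  induction k with
  | zero =>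
    exact measurable_const.prodMk (measurable_pi_lambda _ fun i => hgc i 0 _ measurable_const)
  | succ k ih =>
    have hx : Measurable fun z : ℕ → Fin n → EuclideanSpace ℝ (Fin d) =>
      (dsgt W α g x₀ z k).1 := ih.fst
    have hy : Measurable fun z : ℕ → Fin n → EuclideanSpace ℝ (Fin d) =>
      (dsgt W α g x₀ z k).2 := ih.snd
    have hxi : ∀ i, Measurable fun z : ℕ → Fin n → EuclideanSpace ℝ (Fin d) =>
      (dsgt W α g x₀ z k).1 i := fun i => (measurable_pi_apply i).comp hx
    have hyi : ∀ i, Measurable fun z : ℕ → Fin n → EuclideanSpace ℝ (Fin d) =>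
      (dsgt W α g x₀ z k).2 i := fun i => (measurable_pi_apply i).comp hy
    have hx' : Measurable fun z : ℕ → Fin n → EuclideanSpace ℝ (Fin d) => fun i =>
        ∑ j, W i j • ((dsgt W α g x₀ z k).1 j - α k • (dsgt W α g x₀ z k).2 j) :=
      measurable_pi_lambda _ fun i => Finset.measurable_sum _ fun j _ =>
        ((hxi j).sub ((hyi j).const_smul (α k))).const_smul (W i j)
    refine hx'.prodMk (measurable_pi_lambda _ fun i => ?_)
    exact ((Finset.measurable_sum _ fun j _ => (hyi j).const_smul (W i j)).add
      (hgc i (k + 1) _ hx')).sub (hgc i k _ hx)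

/-- The position at time `k` depends on the samples before time `k` only, the tracker on those up
to time `k`. -/
theorem dsgt_congr (z z' : ℕ → Fin n → EuclideanSpace ℝ (Fin d)) (k : ℕ) :
    ((∀ j < k, z j = z' j) → (dsgt W α g x₀ z k).1 = (dsgt W α g x₀ z' k).1) ∧
      ((∀ j ≤ k, z j = z' j) → (dsgt W α g x₀ z k).2 = (dsgt W α g x₀ z' k).2) := by
  induction k with
  | zero => exact ⟨fun _ => rfl, fun h => by simp [dsgt, h 0 le_rfl]⟩
  | succ k ih =>
    have hx : (∀ j < k + 1, z j = z' j) →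
        (dsgt W α g x₀ z (k + 1)).1 = (dsgt W α g x₀ z' (k + 1)).1 := fun h => by
      simp only [dsgt, ih.1 fun j hj => h j (by omega), ih.2 fun j hj => h j (by omega)]
    refine ⟨hx, fun h => ?_⟩
    simp only [dsgt, ih.1 fun j hj => h j (by omega), ih.2 fun j hj => h j (by omega),
      h (k + 1) le_rfl, h k (by omega)]

variable {Ω : Type*} [MeasurableSpace Ω] {P : Measure Ω}
  {ξ : ℕ → Fin n → Ω → EuclideanSpace ℝ (Fin d)}

/-- The position at time k is a measurable function of the finite block of samples before time k,
which is independent of any sample at time k. -/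
theorem indepFun_dsgt_fst (hg : ∀ i, Measurable (Function.uncurry (g i)))
    (hξ : ∀ k i, Measurable (ξ k i)) (hind : iIndepFun (fun q : ℕ × Fin n => ξ q.1 q.2) P)
    (k : ℕ) (i : Fin n) :
    IndepFun (fun ω => (dsgt W α g x₀ (fun k i => ξ k i ω) k).1) (ξ k i) P := by
  classical
  let S : Finset (ℕ × Fin n) := Finset.range k ×ˢ Finset.univ
  have hdisj : Disjoint S {(k, i)} := by simp [S]
  have h := hind.indepFun_finset S {(k, i)} hdisj fun q => hξ q.1 q.2
  -- Unseen samples are filled with 0; by causality this does not change the position.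
  let ext : (S → EuclideanSpace ℝ (Fin d)) → ℕ → Fin n → EuclideanSpace ℝ (Fin d) :=
    fun r j l => if hq : (j, l) ∈ S then r ⟨(j, l), hq⟩ else 0
  have hext : Measurable ext := by
    refine measurable_pi_lambda _ fun j => measurable_pi_lambda _ fun l => ?_
    by_cases hq : (j, l) ∈ S
    · simpa only [ext, hq, dif_pos] using measurable_pi_apply _
    · simpa only [ext, hq, dif_neg, not_false_iff] using measurable_const
  have hpast : Measurable fun r => (dsgt W α g x₀ (ext r) k).1 :=
    ((measurable_dsgt hg k).comp hext).fst
  have h2 := h.comp hpast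
    (measurable_pi_apply (⟨(k, i), Finset.mem_singleton_self _⟩ : ({(k, i)} : Finset (ℕ × Fin n))))
  suffices heq : (fun ω => (dsgt W α g x₀ (fun k i => ξ k i ω) k).1)
      = (fun r => (dsgt W α g x₀ (ext r) k).1) ∘ fun ω (q : S) => ξ q.1.1 q.1.2 ω by
    rw [heq]
    exact h2
  ext1 ω
  refine (dsgt_congr _ _ k).1 fun j hj => ?_
  ext1 l
  simp [ext, S, hj]

end Iterates

/-! ### Deterministic gradient estimates -/

section Objective

variable {n p : ℕ} {μ L : ℝ} {f : Fin n → EuclideanSpace ℝ (Fin p) → ℝ}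

theorem IsSmoothStronglyConvex.continuous_gradient {f : EuclideanSpace ℝ (Fin p) → ℝ}
    (hf : IsSmoothStronglyConvex μ L f) : Continuous (gradient f) :=
  (LipschitzWith.of_dist_le' (K := L) fun x y => by
    simpa only [dist_eq_norm] using hf.lipschitz x y).continuous

theorem IsSmoothStronglyConvex.norm_sub_sq_le {f : EuclideanSpace ℝ (Fin p) → ℝ}
    (hf : IsSmoothStronglyConvex μ L f) (x y : EuclideanSpace ℝ (Fin p)) :
    ‖gradient f x - gradient f y‖ ^ 2 ≤ L ^ 2 * ‖x - y‖ ^ 2 := by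
  rw [← mul_pow]
  have := hf.lipschitz x y
  gcongr

theorem agentMean_gradient_eq_zero (hf : ∀ i, IsSmoothStronglyConvex μ L (f i))
    {xstar : EuclideanSpace ℝ (Fin p)}
    (hxstar : IsMinOn (fun x => (1 / (n : ℝ)) * ∑ i, f i x) Set.univ xstar) :
    agentMean (fun i => gradient (f i) xstar) = 0 := by
  have hd : HasFDerivAt (fun x => (1 / (n : ℝ)) * ∑ i, f i x)
      ((1 / (n : ℝ)) • ∑ i, InnerProductSpace.toDual ℝ _ (gradient (f i) xstar)) xstar :=
    (HasFDerivAt.fun_sum fun i _ =>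
      ((hf i).differentiable xstar).hasGradientAt.hasFDerivAt).const_mul _
  have h0 := (hxstar.isLocalMin Filter.univ_mem).hasFDerivAt_eq_zero hd
  apply (InnerProductSpace.toDual ℝ (EuclideanSpace ℝ (Fin p))).injective
  rw [map_zero, ← h0]
  simp [agentMean]

/-- The mean of the local gradients, followed along a small step from the mean position, contracts
towards the minimizer up to the consensus error. -/
theorem norm_gradient_step_sq_le [NeZero n] (hμ : 0 < μ)
    (hf : ∀ i, IsSmoothStronglyConvex μ L (f i)) {xstar : EuclideanSpace ℝ (Fin p)}
    (hstar : agentMean (fun i => gradient (f i) xstar) = 0) {α : ℝ} (hα : 0 < α) (hα1 : α ≤ 1)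
    (hαL : α * L ^ 2 ≤ μ / 4) (v : Fin n → EuclideanSpace ℝ (Fin p)) :
    ‖agentMean v - xstar - α • agentMean (fun i => gradient (f i) (v i))‖ ^ 2 ≤
      (1 - α * μ) * ‖agentMean v - xstar‖ ^ 2
        + α * ((1 + 2 / μ) * L ^ 2) * consensusError v := by
  have hn0 : (0 : ℝ) < n := by exact_mod_cast NeZero.pos n
  set e := agentMean v - xstar with he
  set h := agentMean (fun i => gradient (f i) (v i)) with hh
  set H := agentMean (fun i => gradient (f i) (agentMean v)) with hH
  have hHe : H = agentMean (fun i => gradient (f i) (agentMean v) - gradient (f i) xstar) := by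
    have := agentMean_sub (fun i => gradient (f i) (agentMean v)) (fun i => gradient (f i) xstar)
    rw [hstar, sub_zero] at this
    exact this.symm
  have hmono : μ * ‖e‖ ^ 2 ≤ inner ℝ H e := by
    have h1 : ∑ _i : Fin n, μ * ‖e‖ ^ 2 ≤ ∑ i : Fin n,
        inner ℝ (gradient (f i) (agentMean v) - gradient (f i) xstar) e :=
      Finset.sum_le_sum fun i _ => (hf i).strong _ _
    rw [hHe, agentMean, real_inner_smul_left, sum_inner, div_mul_eq_mul_div, one_mul,
      le_div_iff₀ hn0]
    simpa [mul_comm] using h1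
  have hlip : ‖H‖ ^ 2 ≤ L ^ 2 * ‖e‖ ^ 2 := by
    rw [hHe]
    refine (norm_agentMean_sq_le _).trans ?_
    rw [div_mul_eq_mul_div, one_mul, div_le_iff₀ hn0]
    calc _ ≤ ∑ _i : Fin n, L ^ 2 * ‖e‖ ^ 2 :=
          Finset.sum_le_sum fun i _ => (hf i).norm_sub_sq_le _ _
      _ = _ := by simp [mul_comm]
  have hdev : ‖H - h‖ ^ 2 ≤ L ^ 2 * consensusError v := by
    rw [hH, hh, ← agentMean_sub]
    refine (norm_agentMean_sq_le_sum _).trans ?_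
    rw [consensusError, Finset.mul_sum]
    refine Finset.sum_le_sum fun i _ => ?_
    rw [Pi.sub_apply, norm_sub_rev (v i)]
    exact (hf i).norm_sub_sq_le _ _
  have hstep := norm_sub_smul_sq_le hα.le e H hmono hlip
  -- The Young parameter αμ/2 spends part of the contraction 2αμ, leaving rate αμ, and turns the α²
  -- in front of the gradient deviation into order α.
  have hy := norm_add_sq_le_young (e - α • H) (α • (H - h))
    (show 0 < α * μ / 2 by positivity)
  rw [norm_smul, mul_pow, Real.norm_eq_abs, sq_abs] at hy
  have heq : e - α • H + α • (H - h) = e - α • h := by rw [smul_sub]; abel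
  rw [heq] at hy
  have hc1 : (1 + α * μ / 2) * (1 - 2 * α * μ + α ^ 2 * L ^ 2) ≤ 1 - α * μ := by
    have h1 : α ^ 2 * L ^ 2 ≤ α * (μ / 4) := by
      rw [pow_two, mul_assoc]; gcongr
    have h2 : (1 + α * μ / 2) * (1 - 2 * α * μ + α ^ 2 * L ^ 2)
        ≤ (1 + α * μ / 2) * (1 - 2 * α * μ + α * (μ / 4)) := by gcongr
    nlinarith [mul_pos hα hμ]
  have hc2 : (1 + 1 / (α * μ / 2)) * α ^ 2 ≤ α * (1 + 2 / μ) := by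
    have h1 : (1 + 1 / (α * μ / 2)) * α ^ 2 = α * (α + 2 / μ) := by field_simp
    rw [h1]; gcongr
  calc ‖e - α • h‖ ^ 2
      ≤ (1 + α * μ / 2) * ‖e - α • H‖ ^ 2 + (1 + 1 / (α * μ / 2)) * (α ^ 2 * ‖H - h‖ ^ 2) := hy
    _ ≤ (1 + α * μ / 2) * ((1 - 2 * α * μ + α ^ 2 * L ^ 2) * ‖e‖ ^ 2)
        + (1 + 1 / (α * μ / 2)) * (α ^ 2 * (L ^ 2 * consensusError v)) := by gcongr
    _ = ((1 + α * μ / 2) * (1 - 2 * α * μ + α ^ 2 * L ^ 2)) * ‖e‖ ^ 2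
        + ((1 + 1 / (α * μ / 2)) * α ^ 2) * (L ^ 2 * consensusError v) := by ring
    _ ≤ (1 - α * μ) * ‖e‖ ^ 2 + (α * (1 + 2 / μ)) * (L ^ 2 * consensusError v) := by
        have := consensusError_nonneg v
        gcongr
    _ = _ := by ring

theorem norm_gradient_sq_le (hf : ∀ i, IsSmoothStronglyConvex μ L (f i))
    (xstar : EuclideanSpace ℝ (Fin p)) (v : Fin n → EuclideanSpace ℝ (Fin p)) (i : Fin n) :
    ‖gradient (f i) (v i)‖ ^ 2 ≤ 4 * L ^ 2 * (consensusError v + ‖agentMean v - xstar‖ ^ 2)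
      + 2 * ∑ j, ‖gradient (f j) xstar‖ ^ 2 := by
  have h1 : ‖gradient (f i) (v i)‖ ^ 2 ≤ 2 * ‖gradient (f i) (v i) - gradient (f i) xstar‖ ^ 2
      + 2 * ‖gradient (f i) xstar‖ ^ 2 := by
    simpa using norm_add_sq_le_two (gradient (f i) (v i) - gradient (f i) xstar)
      (gradient (f i) xstar)
  have h2 := (hf i).norm_sub_sq_le (v i) xstar
  have h3 := mul_le_mul_of_nonneg_left (norm_sub_sq_le_consensusError v xstar i) (sq_nonneg L)
  have h4 : ‖gradient (f i) xstar‖ ^ 2 ≤ ∑ j, ‖gradient (f j) xstar‖ ^ 2 :=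
    Finset.single_le_sum (f := fun j => ‖gradient (f j) xstar‖ ^ 2)
      (fun _ _ => by positivity) (Finset.mem_univ i)
  linarith

end Objective

/-! ### Square integrability and moments of the samples -/

section SquareIntegrable

variable {Ω : Type*} [MeasurableSpace Ω] {P : Measure Ω} {n p d : ℕ}

theorem memLp_agentMean {v : Ω → Fin n → EuclideanSpace ℝ (Fin p)}
    (hv : ∀ i, MemLp (fun ω => v ω i) 2 P) : MemLp (fun ω => agentMean (v ω)) 2 P := by
  simp only [agentMean]
  exact (memLp_finsetSum _ fun i _ => hv i).const_smul (1 / (n : ℝ))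

theorem MeasureTheory.MemLp.integrable_norm_sq {v : Ω → EuclideanSpace ℝ (Fin p)}
    (hv : MemLp v 2 P) : Integrable (fun ω => ‖v ω‖ ^ 2) P :=
  (memLp_two_iff_integrable_sq_norm hv.1).1 hv

theorem integrable_consensusError {v : Ω → Fin n → EuclideanSpace ℝ (Fin p)}
    (hv : ∀ i, MemLp (fun ω => v ω i) 2 P) : Integrable (fun ω => consensusError (v ω)) P :=
  integrable_finsetSum _ fun i _ => ((hv i).sub (memLp_agentMean hv)).integrable_norm_sq

variable [IsProbabilityMeasure P]

theorem IsSmoothStronglyConvex.memLp_gradient {μ L : ℝ} {f : EuclideanSpace ℝ (Fin p) → ℝ}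
    (hf : IsSmoothStronglyConvex μ L f) {v : Ω → EuclideanSpace ℝ (Fin p)} (hv : MemLp v 2 P) :
    MemLp (fun ω => gradient f (v ω)) 2 P := by
  have h : MemLp (fun ω => gradient f (v ω) - gradient f 0) 2 P := by
    refine hv.of_le_mul (c := L) ((hf.continuous_gradient.comp_aestronglyMeasurable hv.1).sub
      aestronglyMeasurable_const) (Filter.Eventually.of_forall fun ω => ?_)
    simpa using hf.lipschitz (v ω) 0
  have := h.add (memLp_const (gradient f 0))
  refine this.ae_eq (Filter.Eventually.of_forall fun ω => ?_)
  simp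

variable {f : Fin n → EuclideanSpace ℝ (Fin p) → ℝ}
  {g : Fin n → EuclideanSpace ℝ (Fin p) → EuclideanSpace ℝ (Fin d) → EuclideanSpace ℝ (Fin p)}
  {ξ : ℕ → Fin n → Ω → EuclideanSpace ℝ (Fin d)} {μ L σ : ℝ}

/-- The oracle noise at a random position independent of the sample. -/
theorem IsStochasticOracle.noise (hO : IsStochasticOracle P f g ξ σ)
    (hf : ∀ i, IsSmoothStronglyConvex μ L (f i)) {X : Ω → Fin n → EuclideanSpace ℝ (Fin p)}
    (hX : Measurable X) {k : ℕ} {i : Fin n} (hind : IndepFun X (ξ k i) P) :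
    Integrable (fun ω => ‖g i (X ω i) (ξ k i ω) - gradient (f i) (X ω i)‖ ^ 2) P ∧
      ∫ ω, ‖g i (X ω i) (ξ k i ω) - gradient (f i) (X ω i)‖ ^ 2 ∂P ≤ σ ^ 2 :=
  integrable_and_integral_norm_sq_le_of_indepFun
    (φ := fun (x : Fin n → EuclideanSpace ℝ (Fin p)) z => g i (x i) z - gradient (f i) (x i))
    hX (hO.measurable_sample k i) hind
    (by
      have h1 : Measurable fun q : (Fin n → EuclideanSpace ℝ (Fin p)) × EuclideanSpace ℝ (Fin d) =>
        q.1 i := (measurable_pi_apply i).comp measurable_fst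
      exact ((hO.measurable_oracle i).comp (h1.prodMk measurable_snd)).sub
        ((hf i).continuous_gradient.measurable.comp h1))
    (fun x => hO.integrable_sq k i (x i)) (fun x => hO.variance_le k i (x i))

theorem IsStochasticOracle.noise_orthogonal (hO : IsStochasticOracle P f g ξ σ)
    (hf : ∀ i, IsSmoothStronglyConvex μ L (f i)) {X : Ω → Fin n → EuclideanSpace ℝ (Fin p)}
    (hX : Measurable X) {k : ℕ} {i : Fin n} (hind : IndepFun X (ξ k i) P)
    {ψ : (Fin n → EuclideanSpace ℝ (Fin p)) → EuclideanSpace ℝ (Fin p)} (hψ : Measurable ψ)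
    (hψ2 : Integrable (fun ω => ‖ψ (X ω)‖ ^ 2) P) :
    Integrable (fun ω =>
        inner ℝ (ψ (X ω)) (g i (X ω i) (ξ k i ω) - gradient (f i) (X ω i))) P ∧
      ∫ ω, inner ℝ (ψ (X ω)) (g i (X ω i) (ξ k i ω) - gradient (f i) (X ω i)) ∂P = 0 := by
  have h1 : Measurable fun q : (Fin n → EuclideanSpace ℝ (Fin p)) × EuclideanSpace ℝ (Fin d) =>
    q.1 i := (measurable_pi_apply i).comp measurable_fst
  have hφ : Measurable (Function.uncurry fun (x : Fin n → EuclideanSpace ℝ (Fin p)) z =>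
      g i (x i) z - gradient (f i) (x i)) :=
    ((hO.measurable_oracle i).comp (h1.prodMk measurable_snd)).sub
      ((hf i).continuous_gradient.measurable.comp h1)
  have hφX : Measurable fun ω => g i (X ω i) (ξ k i ω) - gradient (f i) (X ω i) :=
    hφ.comp (hX.prodMk (hO.measurable_sample k i))
  have hin := integrable_inner_of_norm_sq (hψ.comp hX) hφX hψ2 (hO.noise hf hX hind).1
  refine ⟨hin, integral_inner_eq_zero_of_indepFun hX (hO.measurable_sample k i) hind hφ hψ
    (fun x => (hO.integrable k i (x i)).sub (integrable_const _)) (fun x => ?_) hin⟩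
  rw [integral_sub (hO.integrable k i (x i)) (integrable_const _), hO.unbiased]
  simp

theorem IsStochasticOracle.memLp_sample (hO : IsStochasticOracle P f g ξ σ)
    (hf : ∀ i, IsSmoothStronglyConvex μ L (f i)) {X : Ω → Fin n → EuclideanSpace ℝ (Fin p)}
    (hX : Measurable X) {k : ℕ} {i : Fin n} (hind : IndepFun X (ξ k i) P)
    (hX2 : MemLp (fun ω => X ω i) 2 P) : MemLp (fun ω => g i (X ω i) (ξ k i ω)) 2 P := by
  have hm : Measurable fun ω => X ω i := (measurable_pi_apply i).comp hX
  have h : MemLp (fun ω => g i (X ω i) (ξ k i ω) - gradient (f i) (X ω i)) 2 P := by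
    refine (memLp_two_iff_integrable_sq_norm ?_).2 (hO.noise hf hX hind).1
    exact (((hO.measurable_oracle i).comp (hm.prodMk (hO.measurable_sample k i))).sub
      ((hf i).continuous_gradient.measurable.comp hm)).aestronglyMeasurable
  refine (h.add ((hf i).memLp_gradient hX2)).ae_eq (Filter.Eventually.of_forall fun ω => ?_)
  simp

/-- The second moment of a sampled gradient. -/
theorem IsStochasticOracle.integral_sample_sq_le (hO : IsStochasticOracle P f g ξ σ)
    (hf : ∀ i, IsSmoothStronglyConvex μ L (f i)) {X : Ω → Fin n → EuclideanSpace ℝ (Fin p)}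
    (hX : Measurable X) {k : ℕ} {i : Fin n} (hind : IndepFun X (ξ k i) P)
    (hX2 : ∀ i, MemLp (fun ω => X ω i) 2 P) (xstar : EuclideanSpace ℝ (Fin p)) :
    ∫ ω, ‖g i (X ω i) (ξ k i ω)‖ ^ 2 ∂P ≤
      (2 * σ ^ 2 + 8 * L ^ 2 + 4 * ∑ j, ‖gradient (f j) xstar‖ ^ 2) *
        (1 + ∫ ω, ‖agentMean (X ω) - xstar‖ ^ 2 ∂P + ∫ ω, consensusError (X ω) ∂P) := by
  obtain ⟨hN, hNle⟩ := hO.noise hf hX hind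
  have ha : Integrable (fun ω => ‖agentMean (X ω) - xstar‖ ^ 2) P :=
    ((memLp_agentMean hX2).sub (memLp_const xstar)).integrable_norm_sq
  have hb := integrable_consensusError hX2
  set D := ∑ j, ‖gradient (f j) xstar‖ ^ 2 with hD
  have hD0 : 0 ≤ D := Finset.sum_nonneg fun _ _ => by positivity
  have ha0 : 0 ≤ ∫ ω, ‖agentMean (X ω) - xstar‖ ^ 2 ∂P := integral_nonneg fun _ => by positivity
  have hb0 : 0 ≤ ∫ ω, consensusError (X ω) ∂P :=
    integral_nonneg fun _ => consensusError_nonneg _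
  have hpt : ∀ ω, ‖g i (X ω i) (ξ k i ω)‖ ^ 2 ≤
      2 * ‖g i (X ω i) (ξ k i ω) - gradient (f i) (X ω i)‖ ^ 2
        + (8 * L ^ 2 * (consensusError (X ω) + ‖agentMean (X ω) - xstar‖ ^ 2) + 4 * D) := by
    intro ω
    have h1 := norm_add_sq_le_two (g i (X ω i) (ξ k i ω) - gradient (f i) (X ω i))
      (gradient (f i) (X ω i))
    rw [sub_add_cancel] at h1
    have h2 := norm_gradient_sq_le hf xstar (X ω) i
    linarith
  have hint : Integrable (fun ω =>
      8 * L ^ 2 * (consensusError (X ω) + ‖agentMean (X ω) - xstar‖ ^ 2) + 4 * D) P :=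
    ((hb.add ha).const_mul _).add (integrable_const _)
  have h := integral_mono (hO.memLp_sample hf hX hind (hX2 i)).integrable_norm_sq
    ((hN.const_mul 2).add hint) hpt
  have hab : Integrable (fun ω => consensusError (X ω) + ‖agentMean (X ω) - xstar‖ ^ 2) P :=
    hb.add ha
  simp only [Pi.add_apply] at h
  rw [integral_add (hN.const_mul 2) hint, integral_add (hab.const_mul _) (integrable_const _),
    integral_const_mul, integral_const_mul, integral_add hb ha] at h
  simp only [integral_const, probReal_univ, smul_eq_mul, one_mul] at h
  refine h.trans ?_
  have hσ2 := sq_nonneg σ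
  have hL2 := sq_nonneg L
  -- Merging all coefficients into one common factor only adds nonnegative products.
  nlinarith [mul_nonneg hσ2 ha0, mul_nonneg hσ2 hb0, mul_nonneg hD0 ha0, mul_nonneg hD0 hb0]

end SquareIntegrable

/-! ### One step of the mean position -/

section Step

variable {Ω : Type*} [MeasurableSpace Ω] {P : Measure Ω} {n p d : ℕ}
  {f : Fin n → EuclideanSpace ℝ (Fin p) → ℝ}
  {g : Fin n → EuclideanSpace ℝ (Fin p) → EuclideanSpace ℝ (Fin d) → EuclideanSpace ℝ (Fin p)}
  {ξ : ℕ → Fin n → Ω → EuclideanSpace ℝ (Fin d)} {μ L σ : ℝ}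

variable [IsProbabilityMeasure P]

/-- One step of the mean position in mean square. -/
theorem IsStochasticOracle.integral_mean_step_le [NeZero n] (hO : IsStochasticOracle P f g ξ σ)
    (hμ : 0 < μ) (hf : ∀ i, IsSmoothStronglyConvex μ L (f i)) {xstar : EuclideanSpace ℝ (Fin p)}
    (hstar : agentMean (fun i => gradient (f i) xstar) = 0) {α : ℝ} (hα : 0 < α) (hα1 : α ≤ 1)
    (hαL : α * L ^ 2 ≤ μ / 4) {X : Ω → Fin n → EuclideanSpace ℝ (Fin p)} (hX : Measurable X)
    {k : ℕ} (hind : ∀ i, IndepFun X (ξ k i) P) (hX2 : ∀ i, MemLp (fun ω => X ω i) 2 P) :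
    ∫ ω, ‖agentMean (X ω) - xstar - α • agentMean (fun i => g i (X ω i) (ξ k i ω))‖ ^ 2 ∂P ≤
      (1 - α * μ) * ∫ ω, ‖agentMean (X ω) - xstar‖ ^ 2 ∂P
        + α * ((1 + 2 / μ) * L ^ 2) * ∫ ω, consensusError (X ω) ∂P + α ^ 2 * σ ^ 2 := by
  have hn0 : (0 : ℝ) < n := by exact_mod_cast NeZero.pos n
  have hgrad : ∀ i, Continuous (gradient (f i)) := fun i => (hf i).continuous_gradient
  let ψ : (Fin n → EuclideanSpace ℝ (Fin p)) → EuclideanSpace ℝ (Fin p) := fun v =>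
    agentMean v - xstar - α • agentMean (fun i => gradient (f i) (v i))
  have hψ : Measurable ψ := by
    refine Continuous.measurable ?_
    simp only [ψ, agentMean]
    fun_prop
  have hmean := memLp_agentMean hX2
  have hψ2 : Integrable (fun ω => ‖ψ (X ω)‖ ^ 2) P := by
    have h1 : MemLp (fun ω => agentMean (fun i => gradient (f i) (X ω i))) 2 P :=
      memLp_agentMean fun i => (hf i).memLp_gradient (hX2 i)
    exact ((hmean.sub (memLp_const xstar)).sub (h1.const_smul α)).integrable_norm_sq
  let ν : Fin n → Ω → EuclideanSpace ℝ (Fin p) := fun i ω =>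
    g i (X ω i) (ξ k i ω) - gradient (f i) (X ω i)
  have hν : ∀ i, Integrable (fun ω => ‖ν i ω‖ ^ 2) P ∧ ∫ ω, ‖ν i ω‖ ^ 2 ∂P ≤ σ ^ 2 := fun i =>
    hO.noise hf hX (hind i)
  have hψν : ∀ i, Integrable (fun ω => inner ℝ (ψ (X ω)) (ν i ω)) P ∧
      ∫ ω, inner ℝ (ψ (X ω)) (ν i ω) ∂P = 0 := fun i =>
    hO.noise_orthogonal hf hX (hind i) hψ hψ2
  have ha : Integrable (fun ω => ‖agentMean (X ω) - xstar‖ ^ 2) P :=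
    (hmean.sub (memLp_const xstar)).integrable_norm_sq
  have hb := integrable_consensusError hX2
  have hG : MemLp (fun ω => agentMean (fun i => g i (X ω i) (ξ k i ω))) 2 P :=
    memLp_agentMean fun i => hO.memLp_sample hf hX (hind i) (hX2 i)
  have hlhs : Integrable (fun ω =>
      ‖agentMean (X ω) - xstar - α • agentMean (fun i => g i (X ω i) (ξ k i ω))‖ ^ 2) P :=
    ((hmean.sub (memLp_const xstar)).sub (hG.const_smul α)).integrable_norm_sq
  have hpt : ∀ ω,
      ‖agentMean (X ω) - xstar - α • agentMean (fun i => g i (X ω i) (ξ k i ω))‖ ^ 2 ≤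
      (1 - α * μ) * ‖agentMean (X ω) - xstar‖ ^ 2
        + α * ((1 + 2 / μ) * L ^ 2) * consensusError (X ω)
        + (-2 * α / n) * ∑ i, inner ℝ (ψ (X ω)) (ν i ω) + α ^ 2 / n * ∑ i, ‖ν i ω‖ ^ 2 := by
    intro ω
    have hN : agentMean (fun i => ν i ω) = agentMean (fun i => g i (X ω i) (ξ k i ω))
        - agentMean (fun i => gradient (f i) (X ω i)) := agentMean_sub _ _
    have heq : agentMean (X ω) - xstar - α • agentMean (fun i => g i (X ω i) (ξ k i ω))
        = ψ (X ω) - α • agentMean (fun i => ν i ω) := by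
      rw [hN, smul_sub]; simp only [ψ]; abel
    have hinner : inner ℝ (ψ (X ω)) (agentMean (fun i => ν i ω))
        = 1 / (n : ℝ) * ∑ i, inner ℝ (ψ (X ω)) (ν i ω) := by
      rw [agentMean, real_inner_smul_right, inner_sum]
    have h1 := norm_gradient_step_sq_le hμ hf hstar hα hα1 hαL (X ω)
    have h2 := mul_le_mul_of_nonneg_left (norm_agentMean_sq_le (fun i => ν i ω)) (sq_nonneg α)
    rw [heq, norm_sub_sq_real, real_inner_smul_right, hinner, norm_smul, mul_pow,
      Real.norm_eq_abs, sq_abs]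
    have e1 : 2 * (α * (1 / (n : ℝ) * ∑ i, inner ℝ (ψ (X ω)) (ν i ω)))
        = - ((-2 * α / n) * ∑ i, inner ℝ (ψ (X ω)) (ν i ω)) := by ring
    have e2 : α ^ 2 * (1 / (n : ℝ) * ∑ i, ‖ν i ω‖ ^ 2) = α ^ 2 / n * ∑ i, ‖ν i ω‖ ^ 2 := by ring
    rw [e1]
    rw [e2] at h2
    change ‖ψ (X ω)‖ ^ 2 ≤ _ at h1
    linarith
  have I1 := ha.const_mul (1 - α * μ)
  have I2 := hb.const_mul (α * ((1 + 2 / μ) * L ^ 2))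
  have I3 : Integrable (fun ω => (-2 * α / n) * ∑ i, inner ℝ (ψ (X ω)) (ν i ω)) P :=
    (integrable_finsetSum _ fun i _ => (hψν i).1).const_mul _
  have I4 : Integrable (fun ω => α ^ 2 / n * ∑ i, ‖ν i ω‖ ^ 2) P :=
    (integrable_finsetSum _ fun i _ => (hν i).1).const_mul _
  refine (integral_mono hlhs (((I1.add I2).add I3).add I4) hpt).trans ?_
  rw [integral_add' ((I1.add I2).add I3) I4, integral_add' (I1.add I2) I3, integral_add' I1 I2,
    integral_const_mul, integral_const_mul, integral_const_mul, integral_const_mul,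
    integral_finsetSum _ fun i _ => (hψν i).1, integral_finsetSum _ fun i _ => (hν i).1]
  -- The cross terms vanish by orthogonality of the noise; only the second-order noise term remains.
  simp only [(hψν _).2, Finset.sum_const_zero, mul_zero, add_zero]
  refine add_le_add le_rfl ?_
  have h5 : ∑ i, ∫ ω, ‖ν i ω‖ ^ 2 ∂P ≤ n * σ ^ 2 := by
    refine (Finset.sum_le_sum fun i _ => (hν i).2).trans ?_
    simp
  calc α ^ 2 / n * ∑ i, ∫ ω, ‖ν i ω‖ ^ 2 ∂P ≤ α ^ 2 / n * (n * σ ^ 2) := by gcongr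
    _ = α ^ 2 * σ ^ 2 := by field_simp

end Step

/-! ### The coupled recursions and their rates -/

section Main

variable {Ω : Type*} [MeasurableSpace Ω] {P : Measure Ω} {n p d : ℕ}
  {f : Fin n → EuclideanSpace ℝ (Fin p) → ℝ}
  {g : Fin n → EuclideanSpace ℝ (Fin p) → EuclideanSpace ℝ (Fin d) → EuclideanSpace ℝ (Fin p)}
  {ξ : ℕ → Fin n → Ω → EuclideanSpace ℝ (Fin d)} {W : Matrix (Fin n) (Fin n) ℝ} {α : ℕ → ℝ}
  {x₀ : Fin n → EuclideanSpace ℝ (Fin p)} {μ L σ : ℝ}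

/-- The mean tracker is the mean of the sampled gradients. -/
theorem agentMean_dsgt_snd (hW : IsCouplingMatrix W) (z : ℕ → Fin n → EuclideanSpace ℝ (Fin d))
    (k : ℕ) : agentMean (dsgt W α g x₀ z k).2
      = agentMean (fun i => g i ((dsgt W α g x₀ z k).1 i) (z k i)) := by
  induction k with
  | zero => rfl
  | succ k ih =>
    have h : (dsgt W α g x₀ z (k + 1)).2
        = (fun i => ∑ j, W i j • (dsgt W α g x₀ z k).2 j)
          + (fun i => g i ((dsgt W α g x₀ z (k + 1)).1 i) (z (k + 1) i))
          - fun i => g i ((dsgt W α g x₀ z k).1 i) (z k i) := rfl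
    rw [h, agentMean_sub, agentMean_add, hW.agentMean_mix, ih]
    abel

/-- Mixing preserves means, so the trackers drop out and the mean performs a stochastic gradient
step. -/
theorem agentMean_dsgt_fst (hW : IsCouplingMatrix W) (z : ℕ → Fin n → EuclideanSpace ℝ (Fin d))
    (k : ℕ) : agentMean (dsgt W α g x₀ z (k + 1)).1
      = agentMean (dsgt W α g x₀ z k).1
        - α k • agentMean (fun i => g i ((dsgt W α g x₀ z k).1 i) (z k i)) := by
  have h : (dsgt W α g x₀ z (k + 1)).1 = fun i => ∑ j, W i j •
      ((dsgt W α g x₀ z k).1 - α k • (dsgt W α g x₀ z k).2) j := rfl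
  rw [h, hW.agentMean_mix, agentMean_sub, agentMean_smul, agentMean_dsgt_snd hW]

theorem IsStochasticOracle.measurable_fst (hO : IsStochasticOracle P f g ξ σ) (k : ℕ) :
    Measurable fun ω => (dsgt W α g x₀ (fun k i => ξ k i ω) k).1 :=
  ((measurable_dsgt hO.measurable_oracle k).comp (measurable_pi_lambda _ fun k =>
    measurable_pi_lambda _ fun i => hO.measurable_sample k i)).fst

variable [IsProbabilityMeasure P]

/-- Gives the integrability behind every expectation below. Positions and trackers are treated
together, since each next position involves the current trackers. -/
theorem IsStochasticOracle.memLp_dsgt (hO : IsStochasticOracle P f g ξ σ)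
    (hf : ∀ i, IsSmoothStronglyConvex μ L (f i)) (k : ℕ) (i : Fin n) :
    MemLp (fun ω => (dsgt W α g x₀ (fun k i => ξ k i ω) k).1 i) 2 P ∧
      MemLp (fun ω => (dsgt W α g x₀ (fun k i => ξ k i ω) k).2 i) 2 P := by
  have hs : ∀ k i, MemLp (fun ω => (dsgt W α g x₀ (fun k i => ξ k i ω) k).1 i) 2 P →
      MemLp (fun ω => g i ((dsgt W α g x₀ (fun k i => ξ k i ω) k).1 i) (ξ k i ω)) 2 P :=
    fun k i => hO.memLp_sample hf (hO.measurable_fst k)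
      (indepFun_dsgt_fst hO.measurable_oracle hO.measurable_sample hO.indep k i)
  induction k generalizing i with
  | zero => exact ⟨memLp_const _, hs 0 i (memLp_const _)⟩
  | succ k ih =>
    have hx : ∀ i, MemLp (fun ω => (dsgt W α g x₀ (fun k i => ξ k i ω) (k + 1)).1 i) 2 P :=
      fun i => memLp_finsetSum Finset.univ fun j _ =>
        ((ih j).1.sub ((ih j).2.const_smul (α k))).const_smul (W i j)
    exact ⟨hx i, ((memLp_finsetSum Finset.univ fun j _ => (ih j).2.const_smul (W i j)).add
      (hs (k + 1) i (hx i))).sub (hs k i (ih i).1)⟩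

/-- The rates of distributed stochastic gradient tracking with stepsizes `θ / (k + 1)`. -/
theorem IsStochasticOracle.dsgt_rates (hO : IsStochasticOracle P f g ξ σ) (hμ : 0 < μ)
    (hf : ∀ i, IsSmoothStronglyConvex μ L (f i)) (hG : (communicationGraph W).Connected)
    (hW : IsCouplingMatrix W) {θ : ℝ} (hθ : 1 / μ < θ) {xstar : EuclideanSpace ℝ (Fin p)}
    (hxstar : IsMinOn (fun x => (1 / (n : ℝ)) * ∑ i, f i x) Set.univ xstar)
    {x y : ℕ → Ω → Fin n → EuclideanSpace ℝ (Fin p)}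
    (hx : ∀ k ω, x k ω = (dsgt W (fun k => θ / ((k : ℝ) + 1)) g x₀ (fun k i => ξ k i ω) k).1)
    (hy : ∀ k ω, y k ω = (dsgt W (fun k => θ / ((k : ℝ) + 1)) g x₀ (fun k i => ξ k i ω) k).2) :
    ∃ U X Y : ℝ, 0 < U ∧ 0 < X ∧ 0 < Y ∧ ∀ k : ℕ, 0 < k →
      ∫ ω, ‖agentMean (x k ω) - xstar‖ ^ 2 ∂P ≤ U / k ∧
      ∫ ω, consensusError (x k ω) ∂P ≤ X / (k : ℝ) ^ 2 ∧
      ∫ ω, consensusError (y k ω) ∂P ≤ Y := by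
  have : Nonempty (Fin n) := hG.nonempty
  have : NeZero n := ⟨by rintro rfl; exact isEmptyElim (Classical.arbitrary (Fin 0))⟩
  have hstar := agentMean_gradient_eq_zero hf hxstar
  obtain ⟨q, hq0, hq1, hq⟩ := hW.exists_contraction hG p
  have hθ0 : 0 < θ := lt_trans (by positivity) hθ
  have hκ : 1 < θ * μ := (div_lt_iff₀ hμ).1 hθ
  obtain rfl : x = fun k ω => (dsgt W (fun k => θ / ((k : ℝ) + 1)) g x₀ (fun k i => ξ k i ω) k).1 :=
    funext fun k => funext fun ω => hx k ω
  obtain rfl : y = fun k ω => (dsgt W (fun k => θ / ((k : ℝ) + 1)) g x₀ (fun k i => ξ k i ω) k).2 :=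
    funext fun k => funext fun ω => hy k ω
  clear hx hy
  set α : ℕ → ℝ := fun k => θ / ((k : ℝ) + 1) with hα
  set x : ℕ → Ω → Fin n → EuclideanSpace ℝ (Fin p) :=
    fun k ω => (dsgt W α g x₀ (fun k i => ξ k i ω) k).1 with hx
  set y : ℕ → Ω → Fin n → EuclideanSpace ℝ (Fin p) :=
    fun k ω => (dsgt W α g x₀ (fun k i => ξ k i ω) k).2 with hy
  have hx2 : ∀ k i, MemLp (fun ω => x k ω i) 2 P := fun k i => (hO.memLp_dsgt hf k i).1
  have hy2 : ∀ k i, MemLp (fun ω => y k ω i) 2 P := fun k i => (hO.memLp_dsgt hf k i).2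
  have hxm : ∀ k, Measurable (x k) := fun k => hO.measurable_fst k
  have hind : ∀ k i, IndepFun (x k) (ξ k i) P := fun k i =>
    indepFun_dsgt_fst hO.measurable_oracle hO.measurable_sample hO.indep k i
  let s : ℕ → Ω → Fin n → EuclideanSpace ℝ (Fin p) := fun k ω i => g i (x k ω i) (ξ k i ω)
  have hs2 : ∀ k i, Integrable (fun ω => ‖s k ω i‖ ^ 2) P := fun k i =>
    (hO.memLp_sample hf (hxm k) (hind k i) (hx2 k i)).integrable_norm_sq
  let a : ℕ → ℝ := fun k => ∫ ω, ‖agentMean (x k ω) - xstar‖ ^ 2 ∂P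
  let b : ℕ → ℝ := fun k => ∫ ω, consensusError (x k ω) ∂P
  let c : ℕ → ℝ := fun k => ∫ ω, consensusError (y k ω) ∂P
  have ha0 : ∀ k, 0 ≤ a k := fun k => integral_nonneg fun _ => by positivity
  have hb0 : ∀ k, 0 ≤ b k := fun k => integral_nonneg fun _ => consensusError_nonneg _
  have hc0 : ∀ k, 0 ≤ c k := fun k => integral_nonneg fun _ => consensusError_nonneg _
  -- η is the Young parameter for both consensus recursions, small enough to keep a contraction.
  obtain ⟨η, hη, hηr⟩ : ∃ η : ℝ, 0 < η ∧ (1 + η) * q < 1 :=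
    ⟨(1 - q) / 2, by linarith, by nlinarith⟩
  set D := 2 * σ ^ 2 + 8 * L ^ 2 + 4 * ∑ j, ‖gradient (f j) xstar‖ ^ 2 with hD
  have hD0 : 0 ≤ D := by positivity
  have hs : ∀ k i, ∫ ω, ‖s k ω i‖ ^ 2 ∂P ≤ D * (1 + a k + b k) := fun k i =>
    hO.integral_sample_sq_le hf (hxm k) (hind k i) (hx2 k) xstar
  -- K is the sum of the forcing coefficients of the three recursions: consensus and noise terms for
  -- a, step term for b, sample moments for c.
  set K := θ * ((1 + 2 / μ) * L ^ 2) + θ ^ 2 * σ ^ 2 + (1 + 1 / η) * θ ^ 2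
    + (1 + 1 / η) * (4 * n * D) with hK
  have hK1 : 0 ≤ θ * ((1 + 2 / μ) * L ^ 2) := by positivity
  have hK2 : 0 ≤ θ ^ 2 * σ ^ 2 := by positivity
  have hK3 : 0 ≤ (1 + 1 / η) * θ ^ 2 := by positivity
  have hK4 : 0 ≤ (1 + 1 / η) * (4 * n * D) := by positivity
  -- From N on, the stepsize meets both smallness conditions of the mean step.
  obtain ⟨N, hN⟩ := exists_nat_gt (max θ (θ * L ^ 2 / (μ / 4)))
  rw [max_lt_iff] at hN
  refine exists_rates (a := a) (b := b) (c := c) (r := (1 + η) * q) (K := K) ha0 hb0 hc0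
    (by positivity) hηr (by positivity) hκ N (fun k hk => ?_) (fun k _ => ?_) (fun k _ => ?_)
  · have hkN : (N : ℝ) ≤ k := by exact_mod_cast hk
    have hk1 : (0 : ℝ) < (k : ℝ) + 1 := by positivity
    have hα0 : 0 < α k := by positivity
    have hα1 : α k ≤ 1 := (div_le_one hk1).2 (by linarith)
    have hαL : α k * L ^ 2 ≤ μ / 4 := by
      have := (div_lt_iff₀ (by positivity)).1 hN.2
      rw [hα, div_mul_eq_mul_div, div_le_iff₀ hk1]
      nlinarith
    have h := hO.integral_mean_step_le hμ hf hstar hα0 hα1 hαL (hxm k) (hind k) (hx2 k)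
    have heq : a (k + 1) = ∫ ω, ‖agentMean (x k ω) - xstar
        - α k • agentMean (fun i => g i (x k ω i) (ξ k i ω))‖ ^ 2 ∂P := by
      refine integral_congr_ae (Filter.Eventually.of_forall fun ω => ?_)
      change ‖agentMean (x (k + 1) ω) - xstar‖ ^ 2 = _
      rw [show agentMean (x (k + 1) ω) = _ from agentMean_dsgt_fst hW _ k, sub_right_comm]
    rw [heq]
    refine h.trans ?_
    change (1 - α k * μ) * a k + α k * ((1 + 2 / μ) * L ^ 2) * b k + α k ^ 2 * σ ^ 2 ≤ _
    have e1 : α k * μ = θ * μ / ((k : ℝ) + 1) := by rw [hα]; ring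
    have e2 : α k * ((1 + 2 / μ) * L ^ 2) ≤ K / ((k : ℝ) + 1) := by
      have : α k * ((1 + 2 / μ) * L ^ 2) = θ * ((1 + 2 / μ) * L ^ 2) / ((k : ℝ) + 1) := by
        rw [hα]; ring
      rw [this]; gcongr; linarith
    have e3 : α k ^ 2 * σ ^ 2 ≤ K / ((k : ℝ) + 1) ^ 2 := by
      have : α k ^ 2 * σ ^ 2 = θ ^ 2 * σ ^ 2 / ((k : ℝ) + 1) ^ 2 := by
        simp only [hα, div_pow]; ring
      rw [this]; gcongr; linarith
    rw [e1]
    have := mul_le_mul_of_nonneg_right e2 (hb0 k)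
    linarith
  · have hpt : ∀ ω, consensusError (x (k + 1) ω) ≤ (1 + η) * q * consensusError (x k ω)
        + K / ((k : ℝ) + 1) ^ 2 * consensusError (y k ω) := by
      intro ω
      have h1 : consensusError (x (k + 1) ω) ≤ q * consensusError (x k ω + (-α k) • y k ω) := by
        refine le_trans (le_of_eq ?_) (hq (x k ω + (-α k) • y k ω))
        congr 1
        ext1 i
        change ∑ j, W i j • (x k ω j - α k • y k ω j) = _
        simp [sub_eq_add_neg]
      have h2 := consensusError_add_le (x k ω) ((-α k) • y k ω) hη
      rw [consensusError_smul, neg_sq] at h2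
      have h3 := mul_le_mul_of_nonneg_left h2 hq0
      have hce := consensusError_nonneg (y k ω)
      have h4 : q * ((1 + 1 / η) * (α k ^ 2 * consensusError (y k ω)))
          ≤ K / ((k : ℝ) + 1) ^ 2 * consensusError (y k ω) := by
        have h5 : q * ((1 + 1 / η) * (α k ^ 2 * consensusError (y k ω)))
            ≤ (1 + 1 / η) * (α k ^ 2 * consensusError (y k ω)) :=
          mul_le_of_le_one_left (by positivity) hq1.le
        refine h5.trans ?_
        have h6 : (1 + 1 / η) * (α k ^ 2 * consensusError (y k ω))
            = (1 + 1 / η) * θ ^ 2 / ((k : ℝ) + 1) ^ 2 * consensusError (y k ω) := by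
          simp only [hα, div_pow]; ring
        rw [h6]; gcongr; linarith
      linarith
    have I1 := (integrable_consensusError (hx2 k)).const_mul ((1 + η) * q)
    have I2 := (integrable_consensusError (hy2 k)).const_mul (K / ((k : ℝ) + 1) ^ 2)
    have h := integral_mono (integrable_consensusError (hx2 (k + 1))) (I1.add I2) hpt
    rwa [integral_add' I1 I2, integral_const_mul, integral_const_mul] at h
  -- The gradient increment is bounded crudely by the two second moments, without using
  -- cancellation; only boundedness of c is needed.
  · have hpt : ∀ ω, consensusError (y (k + 1) ω) ≤ (1 + η) * q * consensusError (y k ω)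
        + (1 + 1 / η) * ∑ i, (2 * ‖s (k + 1) ω i‖ ^ 2 + 2 * ‖s k ω i‖ ^ 2) := by
      intro ω
      have h1 : y (k + 1) ω = (fun i => ∑ j, W i j • y k ω j) + (s (k + 1) ω - s k ω) := by
        ext1 i
        exact add_sub_assoc _ _ _
      have h2 := consensusError_add_le (fun i => ∑ j, W i j • y k ω j) (s (k + 1) ω - s k ω) hη
      have h3 : consensusError (s (k + 1) ω - s k ω)
          ≤ ∑ i, (2 * ‖s (k + 1) ω i‖ ^ 2 + 2 * ‖s k ω i‖ ^ 2) :=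
        (consensusError_le_sum _).trans
          (Finset.sum_le_sum fun i _ => norm_sub_sq_le_two _ _)
      rw [h1, mul_assoc]
      refine h2.trans ?_
      gcongr
      exact hq _
    have I0 : ∀ i, Integrable (fun ω => 2 * ‖s (k + 1) ω i‖ ^ 2 + 2 * ‖s k ω i‖ ^ 2) P :=
      fun i => ((hs2 (k + 1) i).const_mul 2).add ((hs2 k i).const_mul 2)
    have I1 := (integrable_consensusError (hy2 k)).const_mul ((1 + η) * q)
    have I2 : Integrable (fun ω =>
        (1 + 1 / η) * ∑ i, (2 * ‖s (k + 1) ω i‖ ^ 2 + 2 * ‖s k ω i‖ ^ 2)) P :=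
      (integrable_finsetSum _ fun i _ => I0 i).const_mul _
    have h := integral_mono (integrable_consensusError (hy2 (k + 1))) (I1.add I2) hpt
    rw [integral_add' I1 I2, integral_const_mul, integral_const_mul,
      integral_finsetSum _ fun i _ => I0 i] at h
    refine h.trans ?_
    refine add_le_add le_rfl ?_
    have hi : ∀ i, ∫ ω, (2 * ‖s (k + 1) ω i‖ ^ 2 + 2 * ‖s k ω i‖ ^ 2) ∂P
        ≤ 4 * D * (1 + a k + b k + a (k + 1) + b (k + 1)) := by
      intro i
      rw [integral_add ((hs2 (k + 1) i).const_mul 2) ((hs2 k i).const_mul 2),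
        integral_const_mul, integral_const_mul]
      have h1 := hs (k + 1) i
      have h2 := hs k i
      have h3 := mul_nonneg hD0 (ha0 k)
      have h4 := mul_nonneg hD0 (hb0 k)
      have h5 := mul_nonneg hD0 (ha0 (k + 1))
      have h6 := mul_nonneg hD0 (hb0 (k + 1))
      linarith
    have hab : 0 ≤ 1 + a k + b k + a (k + 1) + b (k + 1) := by
      linarith [ha0 k, hb0 k, ha0 (k + 1), hb0 (k + 1)]
    calc (1 + 1 / η) * ∑ i, ∫ ω, (2 * ‖s (k + 1) ω i‖ ^ 2 + 2 * ‖s k ω i‖ ^ 2) ∂P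
        ≤ (1 + 1 / η) * ∑ _i : Fin n, 4 * D * (1 + a k + b k + a (k + 1) + b (k + 1)) := by
          gcongr; exact hi _
      _ = (1 + 1 / η) * (4 * n * D) * (1 + a k + b k + a (k + 1) + b (k + 1)) := by
          simp; ring
      _ ≤ K * (1 + a k + b k + a (k + 1) + b (k + 1)) := by
          gcongr; linarith

end Main

/-! ### The final statement -/

theorem corollary2 {Ω : Type*} [MeasurableSpace Ω] (P : Measure Ω) [IsProbabilityMeasure P]
    {n p d : ℕ}
    (f : Fin n → EuclideanSpace ℝ (Fin p) → ℝ)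
    (g : Fin n → EuclideanSpace ℝ (Fin p) → EuclideanSpace ℝ (Fin d) → EuclideanSpace ℝ (Fin p))
    (ξ : ℕ → Fin n → Ω → EuclideanSpace ℝ (Fin d))
    (W : Matrix (Fin n) (Fin n) ℝ)
    (μ L σ θ m : ℝ) (hμ : 0 < μ) (hσ : 0 < σ)
    (horacle : IsStochasticOracle P f g ξ σ)
    (hf : ∀ i, IsSmoothStronglyConvex μ L (f i))
    (hgraph : (communicationGraph W).Connected)
    (hW : IsCouplingMatrix W)
    (hθ : 1 / μ < θ)
    (hm : OffsetCondition μ L θ (mixingNorm W) (frobeniusSq (W - 1)) m)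
    (x₀ : Fin n → EuclideanSpace ℝ (Fin p))
    (xstar : EuclideanSpace ℝ (Fin p))
    (hxstar : IsMinOn (fun x => (1 / (n : ℝ)) * ∑ i, f i x) Set.univ xstar)
    (x y : ℕ → Ω → Fin n → EuclideanSpace ℝ (Fin p))
    (hx : ∀ k ω, x k ω =
      (dsgt W (fun k => θ / ((k : ℝ) + 1)) g x₀ (fun k i => ξ k i ω) k).1)
    (hy : ∀ k ω, y k ω =
      (dsgt W (fun k => θ / ((k : ℝ) + 1)) g x₀ (fun k i => ξ k i ω) k).2) :
    ∃ U X Y : ℝ, 0 < U ∧ 0 < X ∧ 0 < Y ∧ ∀ k : ℕ, m ≤ (k : ℝ) →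
      (Integrable (fun ω => ‖agentMean (x k ω) - xstar‖ ^ 2) P ∧
        ∫ ω, ‖agentMean (x k ω) - xstar‖ ^ 2 ∂P ≤ U / k) ∧
      (Integrable (fun ω => consensusError (x k ω)) P ∧
        ∫ ω, consensusError (x k ω) ∂P ≤ X / (k : ℝ) ^ 2) ∧
      (Integrable (fun ω => consensusError (y k ω)) P ∧
        ∫ ω, consensusError (y k ω) ∂P ≤ Y) := by
  have hint : ∀ k, Integrable (fun ω => ‖agentMean (x k ω) - xstar‖ ^ 2) P ∧
      Integrable (fun ω => consensusError (x k ω)) P ∧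
      Integrable (fun ω => consensusError (y k ω)) P := by
    intro k
    have h := horacle.memLp_dsgt (W := W) (α := fun k => θ / ((k : ℝ) + 1)) (x₀ := x₀) hf k
    simp only [hx, hy]
    exact ⟨((memLp_agentMean fun i => (h i).1).sub (memLp_const xstar)).integrable_norm_sq,
      integrable_consensusError fun i => (h i).1, integrable_consensusError fun i => (h i).2⟩
  -- In dimension zero the sign of L is not determined, but all errors vanish.
  rcases subsingleton_or_nontrivial (EuclideanSpace ℝ (Fin p)) with hE | hE
  · refine ⟨1, 1, 1, one_pos, one_pos, one_pos, fun k _ => ?_⟩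
    obtain ⟨h1, h2, h3⟩ := hint k
    refine ⟨⟨h1, ?_⟩, ⟨h2, ?_⟩, ⟨h3, ?_⟩⟩
    · simp only [Subsingleton.elim (agentMean _ - xstar) 0]
      simp
    · simp only [consensusError, Subsingleton.elim (_ - agentMean _) 0]
      simp
    · simp only [consensusError, Subsingleton.elim (_ - agentMean _) 0]
      simp
  · obtain ⟨i⟩ := hgraph.nonempty
    obtain ⟨v, hv⟩ := exists_ne (0 : EuclideanSpace ℝ (Fin p))
    have hv0 : 0 < ‖v‖ := norm_pos_iff.2 hv
    have hL : 0 < L := by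
      have h1 := (hf i).strong v 0
      have h2 := (real_inner_le_norm _ _).trans
        (mul_le_mul_of_nonneg_right ((hf i).lipschitz v 0) (norm_nonneg (v - 0)))
      rw [sub_zero] at h1 h2
      have h3 : μ * ‖v‖ ^ 2 ≤ L * ‖v‖ ^ 2 := by linarith
      exact hμ.trans_le (le_of_mul_le_mul_right h3 (by positivity))
    have hθ0 : 0 < θ := lt_trans (by positivity) hθ
    -- Positivity of m turns k ≥ m into k ≥ 1, the range on which the rates hold.
    have hm0 : 0 < m :=
      lt_of_lt_of_le (by positivity : 0 < θ / 2 * (μ + L)) ((le_max_left _ _).trans hm.1.le)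
    obtain ⟨U, X, Y, hU, hX, hY, h⟩ := horacle.dsgt_rates hμ hf hgraph hW hθ hxstar hx hy
    refine ⟨U, X, Y, hU, hX, hY, fun k hk => ?_⟩
    obtain ⟨h1, h2, h3⟩ := h k (by exact_mod_cast hm0.trans_le hk)
    obtain ⟨i1, i2, i3⟩ := hint k
    exact ⟨⟨i1, h1⟩, ⟨i2, h2⟩, ⟨i3, h3⟩⟩
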